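/- Fix $n\ge 2$ and $k\ge 1$. For a Hermitian projection $\pi$ of $\mathbb{C}^n$ put $\pi^\perp=\mathrm{I}-\pi$ and $g_{i,\pi}(\lambda)=\pi+\frac{\lambda+i}{\lambda-i}\,\pi^\perp$. Write $w=x+iy$. An extended uniton is a smooth map $\phi(w,\lambda)\in GL(n,\mathbb{C})$, $w\in\mathbb{C}$, $\lambda\in\mathbb{C}\setminus\{i,-i\}$, which is rational in $\lambda$ with its only pole at $\lambda=i$ and $\phi(w,\infty)=\mathrm{I}$, satisfies $\phi(w,\bar\lambda)^*\phi(w,\lambda)=\mathrm{I}$, is a ($t$-independent) extended solution of the Ward equation, i.e. $\lambda\phi_x-\phi_y=A\phi$ and $-\lambda\phi_y-\phi_x=B\phi$ for some maps $A,B$ independent of $\lambda$, and whose associated harmonic map $\phi(\cdot,0)^{-1}:\mathbb{C}\to U(n)$ extends smoothly to $S^2=\mathbb{C}\cup\{\infty\}$. Let $\phi_k$ be an extended uniton with a minimal factorization $\phi_k=g_{i,\pi_k}\cdots g_{i,\pi_1}$: the $\pi_j$ are smooth maps from $\mathbb{C}$ to the Hermitian projections of $\mathbb{C}^n$ different from $0$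 and $\mathrm{I}$, and $\mathrm{Im}\,\pi_j\cap\mathrm{Im}\,\pi_{j-1}^\perp=0$ for $2\le j\le k$, except possibly at finitely many points of $\mathbb{C}$. Let $m_j=\mathrm{rk}\,\pi_j$ (which is constant), and for $m,j\ge 0$ let $$P_{m,j}=\sum_{m\ge i_1>\cdots>i_j\ge 1}\pi_{i_1}^\perp\cdots\pi_{i_j}^\perp,\qquad P_{m,0}=\mathrm{I}.$$ Then there are positive integers $r_1,\dots,r_s$ with $\sum_{i=1}^s r_i=m_k$ and $\mathbb{C}^n$-valued rational maps $a_{i,0},\dots,a_{i,k-1}$ ($1\le i\le s$) of $w$ such that, with $$D^{(\ell)}v_{im}=\sum_{j=0}^{m-1}(2\sqrt{-1})^jP_{m-1,j}\bigl(a_{i,j}^{(\ell)}\bigr),\qquad v_{im}=D^{(0)}v_{im},$$ where $a^{(\ell)}=d^\ell a/dw^\ell$, the following hold. 1. $a_{i,0}^{(j)}\in\mathrm{Im}\,\pi_1$ for all $1\le i\le s$ and $0\le j\le r_i+k-2$, at every point of $\mathbb{C}$ that is not a pole of $a_{i,0}$. 2. $D^{(j)}v_{ip}\in\mathrm{Im}\,\pi_p$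 for all $1\le i\le s$, $1\le p\le k-1$ and $0\le j\le r_i+k-p-1$, at every point of $\mathbb{C}$ that is not a pole of $a_{i,0},\dots,a_{i,p-1}$. 3. Off a finite subset of $\mathbb{C}$ that contains all poles of the $a_{i,j}$, the vectors $v_{ik},D^{(1)}v_{ik},\dots,D^{(r_i-1)}v_{ik}$, $1\le i\le s$, span $\mathrm{Im}\,\pi_k$ and, unless all of $\pi_1,\dots,\pi_k$ are constant maps, $D^{(r_i)}v_{ik}\notin\mathrm{Im}\,\pi_k$ for every $i$. -/

import Mathlib

open scoped ContDiff

noncomputable section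

namespace Uniton

/-- The vectors of `ℂⁿ`. -/
abbrev Vec (n : ℕ) : Type := Fin n → ℂ

/-- Complex `n × n` matrices; `star` is the conjugate transpose. -/
abbrev Mat (n : ℕ) : Type := Matrix (Fin n) (Fin n) ℂ

/-- The image of a matrix, as a subspace of `ℂⁿ`. -/
def im {n : ℕ} (T : Mat n) : Submodule ℂ (Vec n) := LinearMap.range T.mulVecLin

/-- The derivative at `q` in the direction `e` of a matrix-valued map on space-time. -/
def dirDeriv {n : ℕ} (F : ℝ × ℝ × ℝ → Mat n) (q e : ℝ × ℝ × ℝ) : Mat n :=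
  Matrix.of fun a b => fderiv ℝ (fun p => F p a b) q e

/-- The orthogonal complement `π^⊥ = I - π` of a projection. -/
def perp {n : ℕ} (T : Mat n) : Mat n := 1 - T

/-- Extended solutions of the Ward equation with spectral parameter in `Ω`. A point of space-time is
`(x, y, t)`. With `u = (t + y) / 2` and `v = (t - y) / 2` one has `∂_u = ∂_t + ∂_y` and
`∂_v = ∂_t - ∂_y`, so that `∂_x`, `∂_u`, `∂_v` are the derivatives in the directions `(1, 0, 0)`,
`(0, 1, 1)` and `(0, -1, 1)`. -/
structure IsExtendedWardMap {n : ℕ} (Ω : Set ℂ) (ψ : ℝ × ℝ × ℝ → ℂ → Mat n) : Prop where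
  isOpen : IsOpen Ω
  zero_mem : (0 : ℂ) ∈ Ω
  smooth : ∀ a b, ContDiffOn ℝ ∞ (fun q : (ℝ × ℝ × ℝ) × ℂ => ψ q.1 q.2 a b) (Set.univ ×ˢ Ω)
  isUnit : ∀ q, ∀ l ∈ Ω, IsUnit (ψ q l)
  reality : ∀ q, ∀ l ∈ Ω, starRingEnd ℂ l ∈ Ω →
    star (ψ q (starRingEnd ℂ l)) * ψ q l = 1
  lax : ∃ A B : ℝ × ℝ × ℝ → Mat n, ∀ q, ∀ l ∈ Ω,
    l • dirDeriv (fun p => ψ p l) q (1, 0, 0) - dirDeriv (fun p => ψ p l) q (0, 1, 1)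
      = A q * ψ q l ∧
    l • dirDeriv (fun p => ψ p l) q (0, -1, 1) - dirDeriv (fun p => ψ p l) q (1, 0, 0)
      = B q * ψ q l

/-- Extended unitons, as functions of `w = x + iy` and of the spectral parameter: `φ` is a stationary
extended solution of the Ward equation, it is rational in the spectral parameter with its only pole
at `i` and with value `I` at infinity, and the harmonic map `φ(·, 0)⁻¹` from `ℂ` to `U(n)` extends
smoothly to the sphere `ℂ ∪ {∞}`, on which `ζ = 1 / w` is the coordinate at infinity. -/
structure IsExtendedUniton {n : ℕ} (φ : ℂ → ℂ → Mat n) : Prop where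
  ward : IsExtendedWardMap ({Complex.I, -Complex.I}ᶜ : Set ℂ)
    (fun q l => φ ((q.1 : ℂ) + (q.2.1 : ℂ) * Complex.I) l)
  rational : ∃ (d : ℕ) (C : ℕ → ℂ → Mat n), ∀ w l, l ≠ Complex.I →
    φ w l = 1 + ∑ j ∈ Finset.Icc 1 d, ((l - Complex.I)⁻¹ ^ j) • C j w
  sphere : ∃ K : ℂ → Mat n, (∀ a b, ContDiff ℝ ∞ (fun ζ => K ζ a b)) ∧
    ∀ ζ, ζ ≠ 0 → K ζ = (φ ζ⁻¹ 0)⁻¹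

/-- The simple element `g_{z, π}(l) = π + ((l - z̄) / (l - z)) π^⊥`, for `l ≠ z`. -/
def simpleElement {n : ℕ} (z : ℂ) (T : Mat n) (l : ℂ) : Mat n :=
  T + ((l - starRingEnd ℂ z) / (l - z)) • perp T

/-- The product `g_{z, π_k} ⋯ g_{z, π_1}`. -/
def simpleProd {n : ℕ} (z : ℂ) (π : ℕ → Mat n) (l : ℂ) : ℕ → Mat n
  | 0 => 1
  | k + 1 => simpleElement z (π (k + 1)) l * simpleProd z π l k

/-- `φ = g_{i, π_k} ⋯ g_{i, π_1}` is a minimal factorization, where `π_1, …, π_k` are smooth maps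
from `ℂ` to the Hermitian projections other than `0` and `I`. The transversality condition
`Im π_j ∩ Im π_{j-1}^⊥ = 0` is only required off a finite subset of `ℂ`. -/
structure IsMinimalFactorization {n : ℕ} (φ : ℂ → ℂ → Mat n) (k : ℕ) (π : ℕ → ℂ → Mat n) :
    Prop where
  smooth : ∀ j ∈ Finset.Icc 1 k, ∀ a b, ContDiff ℝ ∞ (fun w => π j w a b)
  proj : ∀ j ∈ Finset.Icc 1 k, ∀ w, IsStarProjection (π j w)
  ne_zero : ∀ j ∈ Finset.Icc 1 k, ∀ w, π j w ≠ 0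
  ne_one : ∀ j ∈ Finset.Icc 1 k, ∀ w, π j w ≠ 1
  factor : ∀ w l, l ≠ Complex.I → φ w l = simpleProd Complex.I (fun j => π j w) l k
  transverse : ∃ S : Set ℂ, S.Finite ∧ ∀ w ∉ S, ∀ j ∈ Finset.Icc 2 k,
    im (π j w) ⊓ im (perp (π (j - 1) w)) = ⊥

/-- `P_{m,j} = ∑_{m ≥ i_1 > ⋯ > i_j ≥ 1} π_{i_1}^⊥ ⋯ π_{i_j}^⊥`; in particular `P_{m,0} = I`. -/
def P {n : ℕ} (π : ℕ → Mat n) (m j : ℕ) : Mat n :=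
  ∑ s ∈ Finset.powersetCard j (Finset.Icc 1 m),
    ((s.sort (fun a b => b ≤ a)).map (fun i => perp (π i))).prod

/-- The map from `ℂ` to `ℂⁿ` given by an `n`-tuple of rational functions, off their poles. -/
def ratMap {n : ℕ} (f : Fin n → RatFunc ℂ) (w : ℂ) : Vec n :=
  fun l => (f l).eval (RingHom.id ℂ) w

/-- The rational map `f` has no pole at `w`. -/
def RegularAt {n : ℕ} (f : Fin n → RatFunc ℂ) (w : ℂ) : Prop :=
  ∀ l, (f l).denom.eval w ≠ 0

/-- `D^{(ℓ)} v_m = ∑_{j=0}^{m-1} (2i)^j P_{m-1,j} (a_j^{(ℓ)})` at the point `w`, for `m ≥ 1`. In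
particular `D^{(0)} v_m = v_m`. -/
def Dv {n : ℕ} (π : ℕ → ℂ → Mat n) (a : ℕ → Fin n → RatFunc ℂ) (ℓ m : ℕ) (w : ℂ) : Vec n :=
  ∑ j ∈ Finset.range m, ((2 * Complex.I) ^ j) •
    (P (fun i => π i w) (m - 1) j).mulVec (iteratedDeriv ℓ (ratMap (a j)) w)

end Uniton

end

/-! Everything is read off from Laurent expansions at `l = i`. Let `φ_p` be the product of the first
`p` simple factors. A tuple `(a_0, …, a_{k-1})` is the series `x = ∑ a_j (l - i)^j` modulo `(l -
i)^k`. The coefficient of `(l - i)^0` in `φ_{p-1} x^{(ℓ)}` is exactly `D^{(ℓ)} v_p`. Over each `w`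
let `W(w)` (`fibre`) be the space of those `x` for which `φ_k x` has no pole at `i`. It is the
kernel of the Hankel matrix of the coefficients `C_j` of `φ_k` (`ker_hankel`), and its dimension
depends only on the ranks of the projections (`finrank_fibre`).

The Ward equation gives `∂C_{j+1} = U C_j` and `∂̄C_{j+1} + 2i ∂̄C_j = V C_j`. The second relation
makes `W` holomorphic in `w`. Smoothness of the harmonic map on the sphere gives `U, V = O(|w|⁻²)`.
As the `C_j` are bounded, they converge at infinity, and compactness of the set of projections shows
that the kernel has the same dimension in the limit. A frame of `W` normalized at infinity is
therefore meromorphic on the plane and bounded near infinity, hence rational. Clearing denominators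
gives polynomial sections that span `W` off a finite set (`exists_model`).

The first relation shows that `j` differentiations of a section create a pole of order at most `j`
in `φ_k x` (`regular_prodAct_derivative`). Transversality removes one order of the pole with each
factor that is dropped (`regular_prodAct_of_pole`). So `φ_{k-j} x^{(j)}` is regular, which puts
`D^{(j)} v_p` in `Im π_p` whenever `j ≤ k - p`. These are the required memberships with every `r_i`
equal to `1`.

On `W(w)` the vector `v_k` vanishes exactly when `a_0` does, so `m_k` sections with independent
leading coefficients give a basis of `Im π_k`. If `D^{(1)} v_k` lies in `Im π_k`, then `x'` lies in
`W`, which off finitely many points is excluded by a polynomial vector, the obstruction. If the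
obstruction vanishes for the whole frame, then `W` is constant, and so are all `π_j`, since they can
be recovered from `W`. Otherwise a small perturbation makes the obstruction of every chosen section
nonzero. -/

namespace Uniton

open Filter Topology Polynomial Asymptotics

/-! ### Growth and rationality of functions of one complex variable -/

/-- An entire function of polynomial growth is a polynomial. -/
theorem exists_polynomial_of_growth {h : ℂ → ℂ} (hd : Differentiable ℂ h) (D : ℕ) (C R : ℝ)
    (hC : ∀ z, R ≤ ‖z‖ → ‖h z‖ ≤ C * ‖z‖ ^ D) : ∃ p : ℂ[X], ∀ z, h z = p.eval z := by
  -- Cauchy's estimate on circles of radius `r → ∞` kills every Taylor coefficient of order above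
  -- `D`.
  have hzero : ∀ j, D < j → iteratedDeriv j h 0 = 0 := by
    intro j hj
    have hb : ∀ r : ℝ, max R 1 ≤ r → ‖iteratedDeriv j h 0‖ ≤ j.factorial * |C| * r⁻¹ := by
      intro r hr
      have hr1 : 1 ≤ r := (le_max_right _ _).trans hr
      have hr0 : 0 < r := by linarith
      have := Complex.norm_iteratedDeriv_le_of_forall_mem_sphere_norm_le (f := h) (c := 0) j hr0
        hd.diffContOnCl (C := |C| * r ^ D) (by
          intro z hz
          have hz' : ‖z‖ = r := by simpa using hz
          refine (hC z (by rw [hz']; exact (le_max_left _ _).trans hr)).trans ?_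
          rw [hz']
          gcongr
          exact le_abs_self C)
      refine this.trans ?_
      rw [div_le_iff₀ (by positivity)]
      have : r ^ D ≤ r⁻¹ * r ^ j := by
        obtain ⟨i, rfl⟩ := Nat.exists_eq_add_of_lt hj
        rw [pow_succ', inv_mul_cancel_left₀ hr0.ne']
        exact pow_le_pow_right₀ hr1 (by omega)
      calc (j.factorial : ℝ) * (|C| * r ^ D) ≤ j.factorial * (|C| * (r⁻¹ * r ^ j)) := by gcongr
        _ = _ := by ring
    have ht : Tendsto (fun r : ℝ => (j.factorial : ℝ) * |C| * r⁻¹) atTop (𝓝 0) := by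
      simpa using tendsto_inv_atTop_zero.const_mul ((j.factorial : ℝ) * |C|)
    have := ge_of_tendsto ht (eventually_atTop.2 ⟨_, hb⟩)
    simpa using this
  refine ⟨∑ j ∈ Finset.range (D + 1),
    Polynomial.C ((j.factorial : ℂ)⁻¹ * iteratedDeriv j h 0) * X ^ j, fun z => ?_⟩
  rw [← Complex.taylorSeries_eq_of_entire' 0 z hd, tsum_eq_sum (s := Finset.range (D + 1))]
  · simp [eval_finsetSum]
  · intro j hj
    rw [hzero j (by simpa using hj)]
    simp

/-- A function that is meromorphic on the plane, and holomorphic and bounded near infinity, is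
rational. -/
theorem exists_rational_of_meromorphic {g : ℂ → ℂ} (hg : ∀ z, MeromorphicAt g z) (R M : ℝ)
    (hR : ∀ z, R < ‖z‖ → DifferentiableAt ℂ g z) (hM : ∀ z, R < ‖z‖ → ‖g z‖ ≤ M) :
    ∃ p q : ℂ[X], q ≠ 0 ∧ ∀ z, q.eval z * g z = p.eval z := by
  choose N hN using hg
  obtain ⟨t, -, ht⟩ := (isCompact_closedBall (0 : ℂ) R).elim_nhds_subcover
    (fun z => {w | AnalyticAt ℂ (fun w => (w - z) ^ N z • g w) w})
    (fun z _ => (isOpen_analyticAt ℂ _).mem_nhds (hN z))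
  -- Finitely many neighbourhoods cover the disc, so this product clears all poles and `q g` is
  -- entire of polynomial growth.
  set q : ℂ[X] := ∏ z ∈ t, (X - C z) ^ N z with hq
  have hq0 : q ≠ 0 := (monic_prod_of_monic _ _ fun z _ => (monic_X_sub_C z).pow _).ne_zero
  have hqa : ∀ (p : ℂ[X]) (w : ℂ), AnalyticAt ℂ (fun w => p.eval w) w := fun p w =>
    AnalyticOnNhd.eval_polynomial p w trivial
  have han : Differentiable ℂ fun w => q.eval w * g w := by
    intro w
    by_cases hw : R < ‖w‖
    · exact (hqa q w).differentiableAt.mul (hR w hw)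
    · obtain ⟨z, hz, hzw⟩ : ∃ z ∈ t, AnalyticAt ℂ (fun w => (w - z) ^ N z • g w) w := by
        simpa using ht (show w ∈ Metric.closedBall 0 R by simpa using hw)
      have : (fun w => q.eval w * g w) = fun w =>
          (∏ z ∈ t.erase z, (X - C z) ^ N z).eval w * ((w - z) ^ N z • g w) := by
        funext w
        rw [hq, ← Finset.mul_prod_erase t _ hz]
        simp only [eval_mul, eval_pow, eval_sub, eval_X, eval_C, smul_eq_mul]
        ring
      rw [this]
      exact ((hqa _ w).mul hzw).differentiableAt
  obtain ⟨c, hc⟩ : ∃ c : ℝ, ∀ z : ℂ, 1 ≤ ‖z‖ → ‖q.eval z‖ ≤ c * ‖z‖ ^ q.natDegree := by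
    refine ⟨∑ j ∈ Finset.range (q.natDegree + 1), ‖q.coeff j‖, fun z hz => ?_⟩
    rw [eval_eq_sum_range, Finset.sum_mul]
    refine (norm_sum_le _ _).trans (Finset.sum_le_sum fun j hj => ?_)
    rw [norm_mul, norm_pow]
    have hj' : j ≤ q.natDegree := by simpa [Nat.lt_succ_iff] using hj
    gcongr
  obtain ⟨p, hp⟩ := exists_polynomial_of_growth han q.natDegree (|c| * |M|) (max (R + 1) 1) (by
    intro z hz
    have h1 : 1 ≤ ‖z‖ := (le_max_right _ _).trans hz
    have h2 : R < ‖z‖ := by linarith [(le_max_left (R + 1) 1).trans hz]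
    rw [norm_mul]
    calc ‖q.eval z‖ * ‖g z‖ ≤ (|c| * ‖z‖ ^ q.natDegree) * |M| := by
          gcongr
          · exact (hc z h1).trans (by gcongr; exact le_abs_self c)
          · exact (hM z h2).trans (le_abs_self M)
      _ = _ := by ring)
  exact ⟨p, q, hq0, hp⟩

/-! ### Wirtinger derivatives -/

/-- For `s = -i` and `s = i`, the Wirtinger derivatives `∂ / ∂w` and `∂ / ∂w̄`. -/
noncomputable def wd (s : ℂ) (f : ℂ → ℂ) (w : ℂ) : ℂ :=
  (fderiv ℝ f w 1 + s * fderiv ℝ f w Complex.I) / 2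

theorem wd_const (s c w : ℂ) : wd s (fun _ => c) w = 0 := by simp [wd]

theorem wd_mul (s : ℂ) {f g : ℂ → ℂ} {w : ℂ} (hf : DifferentiableAt ℝ f w)
    (hg : DifferentiableAt ℝ g w) :
    wd s (fun z => f z * g z) w = wd s f w * g w + f w * wd s g w := by
  simp only [wd, fderiv_fun_mul hf hg, add_apply,
    smul_apply, smul_eq_mul]
  ring

theorem wd_sum (s : ℂ) {α : Type*} {t : Finset α} {f : α → ℂ → ℂ} {w : ℂ}
    (hf : ∀ i ∈ t, DifferentiableAt ℝ (f i) w) :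
    wd s (fun z => ∑ i ∈ t, f i z) w = ∑ i ∈ t, wd s (f i) w := by
  simp only [wd, fderiv_fun_sum hf, sum_apply]
  rw [Finset.mul_sum, ← Finset.sum_add_distrib, Finset.sum_div]

theorem wd_congr (s : ℂ) {f g : ℂ → ℂ} {w : ℂ} (h : f =ᶠ[𝓝 w] g) : wd s f w = wd s g w := by
  rw [wd, wd, h.fderiv_eq]

theorem wd_polynomial (p : ℂ[X]) (w : ℂ) :
    wd (-Complex.I) (fun z => p.eval z) w = p.derivative.eval w := by
  have h : HasFDerivAt (fun z => p.eval z) _ w :=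
    ((p.hasDerivAt w).hasFDerivAt).restrictScalars ℝ
  rw [wd, h.fderiv]
  simp only [ContinuousLinearMap.coe_restrictScalars', ContinuousLinearMap.toSpanSingleton_apply,
    smul_eq_mul]
  linear_combination (-(1 / 2) * eval w (derivative p)) * Complex.I_mul_I

theorem differentiableAt_of_wd_eq_zero {f : ℂ → ℂ} {w : ℂ} (hf : DifferentiableAt ℝ f w)
    (h : wd Complex.I f w = 0) : DifferentiableAt ℂ f w := by
  rw [differentiableAt_complex_iff_differentiableAt_real]
  refine ⟨hf, ?_⟩
  rw [wd, div_eq_zero_iff] at h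
  have h := h.resolve_right two_ne_zero
  rw [smul_eq_mul]
  linear_combination (-Complex.I) * h + (fderiv ℝ f w Complex.I) * Complex.I_mul_I

/-- The entrywise Wirtinger derivative of a matrix-valued map. -/
noncomputable def wdM {α β : Type*} (s : ℂ) (F : ℂ → Matrix α β ℂ) (w : ℂ) : Matrix α β ℂ :=
  Matrix.of fun a b => wd s (fun z => F z a b) w

theorem wdM_mul (s : ℂ) {α β γ : Type*} [Fintype β] {F : ℂ → Matrix α β ℂ}
    {G : ℂ → Matrix β γ ℂ} {w : ℂ} (hF : ∀ a b, DifferentiableAt ℝ (fun z => F z a b) w)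
    (hG : ∀ a b, DifferentiableAt ℝ (fun z => G z a b) w) :
    wdM s (fun z => F z * G z) w = wdM s F w * G w + F w * wdM s G w := by
  ext a b
  simp only [wdM, Matrix.of_apply, Matrix.mul_apply, Matrix.add_apply]
  refine (wd_sum s fun i _ => (hF a i).fun_mul (hG i b)).trans ?_
  rw [← Finset.sum_add_distrib]
  exact Finset.sum_congr rfl fun i _ => wd_mul s (hF a i) (hG i b)

theorem wdM_const (s : ℂ) {α β : Type*} (A : Matrix α β ℂ) (w : ℂ) :
    wdM s (fun _ => A) w = 0 := by
  ext a b
  simp [wdM, wd_const]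

theorem wdM_congr (s : ℂ) {α β : Type*} {F G : ℂ → Matrix α β ℂ} {w : ℂ} (h : F =ᶠ[𝓝 w] G) :
    wdM s F w = wdM s G w := by
  ext a b
  exact wd_congr s (h.mono fun z hz => congrFun (congrFun hz a) b)

/-! ### Holomorphic families of kernels and their polynomial frames -/

section Frame

variable {ι : Type*} [Fintype ι] [DecidableEq ι]

/-- The kernel of a matrix. -/
def ker {α β : Type*} [Fintype β] (A : Matrix α β ℂ) : Submodule ℂ (β → ℂ) :=
  LinearMap.ker A.mulVecLin

theorem mem_ker {α β : Type*} [Fintype β] {A : Matrix α β ℂ} {x : β → ℂ} :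
    x ∈ ker A ↔ A.mulVec x = 0 := by
  simp [ker]

/-- The columns of `e` are a basis of the kernel, `c` is a left inverse of `e`, and `R` inverts `A`
on the complement `ker c`. The combination `e c + R A'` is the identity at `A' = A`, hence stays
invertible for nearby `A'`; this yields local charts for the kernel. -/
theorem exists_normalized_complement {m : ℕ} (A : Matrix ι ι ℂ)
    (hA : Module.finrank ℂ (ker A) = m) :
    ∃ (c : Matrix (Fin m) ι ℂ) (e : Matrix ι (Fin m) ℂ) (R : Matrix ι ι ℂ),
      c * e = 1 ∧ c * R = 0 ∧ e * c + R * A = 1 := by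
  let b : (Fin m → ℂ) ≃ₗ[ℂ] ker A :=
    (LinearEquiv.ofFinrankEq _ _ (by simpa using hA.symm))
  let e : (Fin m → ℂ) →ₗ[ℂ] (ι → ℂ) := (ker A).subtype ∘ₗ b.toLinearMap
  have he : LinearMap.ker e = ⊥ := by
    rw [LinearMap.ker_eq_bot]
    exact (ker A).injective_subtype.comp b.injective
  obtain ⟨c, hc⟩ := e.exists_leftInverse_of_injective he
  have hc' : ∀ x, c (e x) = x := fun x => LinearMap.congr_fun hc x
  have hAe : ∀ x, A.mulVecLin (e x) = 0 := fun x => (b x).2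
  have hAW : LinearMap.ker (A.mulVecLin ∘ₗ (LinearMap.ker c).subtype) = ⊥ := by
    rw [LinearMap.ker_eq_bot']
    intro x hx
    have hx' : (x : ι → ℂ) ∈ ker A := hx
    have h1 : e (b.symm ⟨x, hx'⟩) = x := by simp [e]
    have h2 : c x = 0 := x.2
    rw [← h1, hc'] at h2
    rw [h2, map_zero] at h1
    exact Subtype.ext h1.symm
  obtain ⟨R, hR⟩ := LinearMap.exists_leftInverse_of_injective _ hAW
  have hR' : ∀ x : LinearMap.ker c, R (A.mulVecLin x) = x := fun x => LinearMap.congr_fun hR x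
  refine ⟨LinearMap.toMatrix' c, LinearMap.toMatrix' e,
    LinearMap.toMatrix' ((LinearMap.ker c).subtype ∘ₗ R), ?_, ?_, ?_⟩
  · rw [← LinearMap.toMatrix'_comp, hc, LinearMap.toMatrix'_id]
  · have hcR : c ∘ₗ (LinearMap.ker c).subtype ∘ₗ R = 0 := LinearMap.ext fun x => (R x).2
    rw [← LinearMap.toMatrix'_comp, hcR, map_zero]
  · have : LinearMap.toMatrix' A.mulVecLin = A := LinearMap.toMatrix'_toLin' A
    conv_lhs => rw [← this]
    rw [← LinearMap.toMatrix'_comp, ← LinearMap.toMatrix'_comp, ← map_add,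
      ← LinearMap.toMatrix'_id]
    congr 1
    refine LinearMap.ext fun x => ?_
    have hx : x - e (c x) ∈ LinearMap.ker c := by simp [hc']
    have := hR' ⟨_, hx⟩
    simp only [map_sub, hAe, sub_zero] at this
    have h2 := congrArg Subtype.val this
    change e (c x) + (R (A.mulVecLin x) : ι → ℂ) = x
    rw [h2, add_sub_cancel]

/-- If `Z = e c + R A` is invertible, then the columns of `Z⁻¹ e` are the basis of the kernel of `A`
that is normalized by `c`. -/
theorem frame_spec {m : ℕ} {A R : Matrix ι ι ℂ} {c : Matrix (Fin m) ι ℂ}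
    {e : Matrix ι (Fin m) ℂ} (hA : Module.finrank ℂ (ker A) = m) (hce : c * e = 1)
    (hcR : c * R = 0) (hZ : IsUnit (e * c + R * A).det) :
    A * ((e * c + R * A)⁻¹ * e) = 0 ∧ c * ((e * c + R * A)⁻¹ * e) = 1 ∧
      ∀ x, A.mulVec x = 0 → x = ((e * c + R * A)⁻¹ * e).mulVec (c.mulVec x) := by
  set Z := e * c + R * A with hZdef
  set f := Z⁻¹ * e with hf
  have hZf : Z * f = e := by rw [hf, Matrix.mul_nonsing_inv_cancel_left _ _ hZ]
  have hcf : c * f = 1 := by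
    have hcZ : c * Z = c := by
      rw [hZdef, Matrix.mul_add, ← Matrix.mul_assoc, hce, ← Matrix.mul_assoc, hcR,
        Matrix.zero_mul, Matrix.one_mul, add_zero]
    have : c * (Z * f) = c * f := by rw [← Matrix.mul_assoc c Z f, hcZ]
    rw [← this, hZf, hce]
  have hker : ∀ x, (R * A).mulVec x = 0 → x = f.mulVec (c.mulVec x) := by
    intro x hx
    have h1 : Z.mulVec x = e.mulVec (c.mulVec x) := by
      rw [hZdef, Matrix.add_mulVec, hx, add_zero, Matrix.mulVec_mulVec]
    rw [hf, ← Matrix.mulVec_mulVec, ← h1, Matrix.mulVec_mulVec, Matrix.nonsing_inv_mul _ hZ,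
      Matrix.one_mulVec]
  have hRAf : R * A * f = 0 := by
    have : e * c * f + R * A * f = e := by rw [← Matrix.add_mul, ← hZdef, hZf]
    rwa [Matrix.mul_assoc e, hcf, Matrix.mul_one, add_eq_left] at this
  have hle : ker A ≤ ker (R * A) := by
    intro x hx
    rw [mem_ker] at hx ⊢
    rw [← Matrix.mulVec_mulVec, hx, Matrix.mulVec_zero]
  have hle' : ker (R * A) ≤ LinearMap.range f.mulVecLin := by
    intro x hx
    exact ⟨c.mulVec x, (hker x (mem_ker.1 hx)).symm⟩
  have hfr : Module.finrank ℂ (LinearMap.range f.mulVecLin) ≤ m := by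
    simpa using LinearMap.finrank_range_le f.mulVecLin
  -- `R` need not be injective, so `ker (R A)` could be larger than `ker A`; it lies in the range of
  -- `f`, which has dimension at most `m`, and this forces equality.
  have heq : ker A = ker (R * A) := Submodule.eq_of_le_of_finrank_le hle
    ((Submodule.finrank_mono hle').trans (hfr.trans hA.ge))
  refine ⟨?_, hcf, fun x hx => hker x ?_⟩
  · refine Matrix.ext_of_mulVec_single fun j => ?_
    have : f.mulVec (Pi.single j 1) ∈ ker (R * A) := by
      rw [mem_ker, Matrix.mulVec_mulVec, hRAf, Matrix.zero_mulVec]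
    rw [← heq, mem_ker] at this
    rw [← Matrix.mulVec_mulVec, this, Matrix.zero_mulVec]
  · exact mem_ker.1 (hle (mem_ker.2 hx))

theorem differentiableAt_det {α : Type*} [Fintype α] [DecidableEq α] {𝕜 : Type*}
    [NontriviallyNormedField 𝕜] [NormedAlgebra 𝕜 ℂ] {F : ℂ → Matrix α α ℂ} {w : ℂ}
    (hF : ∀ a b, DifferentiableAt 𝕜 (fun z => F z a b) w) :
    DifferentiableAt 𝕜 (fun z => (F z).det) w := by
  simp only [Matrix.det_apply]
  refine DifferentiableAt.fun_sum fun σ _ => ?_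
  refine DifferentiableAt.const_smul ?_ _
  exact (HasFDerivAt.finsetProd fun i _ => (hF (σ i) i).hasFDerivAt).differentiableAt

theorem differentiableAt_adjugate {α : Type*} [Fintype α] [DecidableEq α] {𝕜 : Type*}
    [NontriviallyNormedField 𝕜] [NormedAlgebra 𝕜 ℂ] {F : ℂ → Matrix α α ℂ} {w : ℂ}
    (hF : ∀ a b, DifferentiableAt 𝕜 (fun z => F z a b) w) (a b : α) :
    DifferentiableAt 𝕜 (fun z => (F z).adjugate a b) w := by
  simp only [Matrix.adjugate_apply]
  refine differentiableAt_det fun i j => ?_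
  by_cases h : i = b
  · simp [Matrix.updateRow_apply, h]
  · simpa [Matrix.updateRow_apply, h] using hF i j

theorem differentiableAt_matrix_mul {α β γ : Type*} [Fintype β] {𝕜 : Type*}
    [NontriviallyNormedField 𝕜] [NormedAlgebra 𝕜 ℂ] {F : ℂ → Matrix α β ℂ}
    {G : ℂ → Matrix β γ ℂ} {w : ℂ}
    (hF : ∀ a b, DifferentiableAt 𝕜 (fun z => F z a b) w)
    (hG : ∀ a b, DifferentiableAt 𝕜 (fun z => G z a b) w) (a : α) (b : γ) :
    DifferentiableAt 𝕜 (fun z => (F z * G z) a b) w := by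
  simp only [Matrix.mul_apply]
  exact DifferentiableAt.fun_sum fun i _ => (hF a i).fun_mul (hG i b)

theorem differentiableAt_inv_matrix {α : Type*} [Fintype α] [DecidableEq α] {𝕜 : Type*}
    [NontriviallyNormedField 𝕜] [NormedAlgebra 𝕜 ℂ] {F : ℂ → Matrix α α ℂ} {w : ℂ}
    (hF : ∀ a b, DifferentiableAt 𝕜 (fun z => F z a b) w) (h0 : (F w).det ≠ 0) (a b : α) :
    DifferentiableAt 𝕜 (fun z => (F z)⁻¹ a b) w := by
  simp only [Matrix.inv_def, Ring.inverse_eq_inv', Matrix.smul_apply, smul_eq_mul]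
  exact ((differentiableAt_det hF).fun_inv h0).fun_mul (differentiableAt_adjugate hF a b)

theorem continuousAt_inv_matrix {α : Type*} [Fintype α] [DecidableEq α] {A : Matrix α α ℂ}
    (hA : A.det ≠ 0) : ContinuousAt (fun B : Matrix α α ℂ => B⁻¹) A := by
  simp only [Matrix.inv_def, Ring.inverse_eq_inv']
  exact (continuous_id.matrix_det.continuousAt.inv₀ hA).smul
    continuous_id.matrix_adjugate.continuousAt

variable {H : ℂ → Matrix ι ι ℂ} {m : ℕ}

/-- The normalized frames of a holomorphic family of kernels are holomorphic. -/
theorem differentiableAt_frame (hH : ∀ a b, Differentiable ℝ fun w => H w a b)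
    (hker : ∀ w, Module.finrank ℂ (ker (H w)) = m)
    (hdbar : ∀ w x, (H w).mulVec x = 0 → (wdM Complex.I H w).mulVec x = 0)
    {c : Matrix (Fin m) ι ℂ} {e : Matrix ι (Fin m) ℂ} {R : Matrix ι ι ℂ}
    (hce : c * e = 1) (hcR : c * R = 0) {w : ℂ} (hw : (e * c + R * H w).det ≠ 0) (a : ι)
    (b : Fin m) : DifferentiableAt ℂ (fun z => ((e * c + R * H z)⁻¹ * e) a b) w := by
  set f : ℂ → Matrix ι (Fin m) ℂ := fun z => (e * c + R * H z)⁻¹ * e with hf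
  have hZ : ∀ z a b, DifferentiableAt ℝ (fun z => (e * c + R * H z) a b) z := by
    intro z a b
    simp only [Matrix.add_apply]
    exact (differentiableAt_const _).fun_add
      (differentiableAt_matrix_mul (F := fun _ => R) (fun _ _ => differentiableAt_const _)
        (fun a b => hH a b z) a b)
  have hev : ∀ᶠ z in 𝓝 w, (e * c + R * H z).det ≠ 0 :=
    (differentiableAt_det (𝕜 := ℝ) (hZ w)).continuousAt.eventually_ne hw
  have hfd : ∀ a b, DifferentiableAt ℝ (fun z => f z a b) w := fun a b =>
    differentiableAt_matrix_mul (G := fun _ => e) (differentiableAt_inv_matrix (hZ w) hw)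
      (fun _ _ => differentiableAt_const _) a b
  have hspec := fun z (hz : (e * c + R * H z).det ≠ 0) =>
    frame_spec (hker z) hce hcR (isUnit_iff_ne_zero.2 hz)
  -- Differentiating `c f = 1` and `H f = 0` gives `c ∂̄f = 0` and `H ∂̄f = 0`, the latter because
  -- `∂̄H` annihilates the kernel. Hence `e c + R H`, which is invertible, annihilates `∂̄f`.
  have h1 : c * wdM Complex.I f w = 0 := by
    have h := wdM_mul Complex.I (F := fun _ => c) (w := w) (fun _ _ => differentiableAt_const _) hfd
    rw [wdM_const, Matrix.zero_mul, zero_add] at h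
    rw [← h, wdM_congr (G := fun _ => 1) _ (hev.mono fun z hz => (hspec z hz).2.1), wdM_const]
  have h2 : H w * wdM Complex.I f w = 0 := by
    have h := wdM_mul Complex.I (w := w) (fun a b => hH a b w) hfd
    rw [wdM_congr (G := fun _ => 0) _ (hev.mono fun z hz => (hspec z hz).1), wdM_const] at h
    have h3 : wdM Complex.I H w * f w = 0 := by
      refine Matrix.ext_of_mulVec_single fun j => ?_
      rw [← Matrix.mulVec_mulVec, hdbar, Matrix.zero_mulVec]
      rw [Matrix.mulVec_mulVec, (hspec w hw).1, Matrix.zero_mulVec]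
    rw [h3, zero_add] at h
    exact h.symm
  have h3 : wdM Complex.I f w = 0 := by
    have h : (e * c + R * H w) * wdM Complex.I f w = 0 := by
      rw [Matrix.add_mul, Matrix.mul_assoc, Matrix.mul_assoc, h1, h2]
      simp
    rw [← Matrix.nonsing_inv_mul_cancel_left _ (wdM Complex.I f w) (isUnit_iff_ne_zero.2 hw), h,
      Matrix.mul_zero]
  exact differentiableAt_of_wd_eq_zero (hfd a b) (congrFun (congrFun h3 a) b)

/-- A smooth family of kernels of constant dimension that is holomorphic and has a limit at infinity
of the same dimension is spanned by polynomials off a finite set. -/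
theorem exists_polynomial_frame (hH : ∀ a b, Differentiable ℝ fun w => H w a b)
    (hker : ∀ w, Module.finrank ℂ (ker (H w)) = m)
    (hdbar : ∀ w x, (H w).mulVec x = 0 → (wdM Complex.I H w).mulVec x = 0)
    {Hlim : Matrix ι ι ℂ} (hlim : Tendsto H (cocompact ℂ) (𝓝 Hlim))
    (hkerlim : Module.finrank ℂ (ker Hlim) = m) :
    ∃ (c : Matrix (Fin m) ι ℂ) (p : Matrix ι (Fin m) ℂ[X]) (q : ℂ[X]), q ≠ 0 ∧
      (∀ w, H w * p.map (eval w) = 0) ∧ c.map C * p = q • (1 : Matrix (Fin m) (Fin m) ℂ[X]) := by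
  classical
  obtain ⟨c, e, R, hce, hcR, hZ⟩ := exists_normalized_complement Hlim hkerlim
  -- The frame normalized by `c`, the left inverse chosen at infinity. The value `0` where no such
  -- frame exists agrees with the convention that a singular matrix has inverse `0`, so the chart
  -- formula `hchart` holds without exception.
  let g : ℂ → Matrix ι (Fin m) ℂ := fun w =>
    if h : ∃ f : Matrix ι (Fin m) ℂ, H w * f = 0 ∧ c * f = 1 then h.choose else 0
  have hHg : ∀ w, H w * g w = 0 := by
    intro w
    by_cases h : ∃ f : Matrix ι (Fin m) ℂ, H w * f = 0 ∧ c * f = 1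
    · simp only [g, dif_pos h]
      exact h.choose_spec.1
    · simp only [g, dif_neg h, Matrix.mul_zero]
  have hchart : ∀ {c₀ : Matrix (Fin m) ι ℂ} {e₀ : Matrix ι (Fin m) ℂ} {R₀ : Matrix ι ι ℂ},
      c₀ * e₀ = 1 → c₀ * R₀ = 0 → ∀ {w : ℂ}, (e₀ * c₀ + R₀ * H w).det ≠ 0 →
      g w = ((e₀ * c₀ + R₀ * H w)⁻¹ * e₀) * (c * ((e₀ * c₀ + R₀ * H w)⁻¹ * e₀))⁻¹ := by
    intro c₀ e₀ R₀ h1 h2 w hw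
    obtain ⟨hf1, hf2, hf3⟩ := frame_spec (hker w) h1 h2 (isUnit_iff_ne_zero.2 hw)
    set f₀ := (e₀ * c₀ + R₀ * H w)⁻¹ * e₀
    have hcoord : ∀ f : Matrix ι (Fin m) ℂ, H w * f = 0 → f = f₀ * (c₀ * f) := by
      intro f h3
      refine Matrix.ext_of_mulVec_single fun j => ?_
      rw [← Matrix.mulVec_mulVec _ f₀, ← Matrix.mulVec_mulVec _ c₀]
      exact hf3 (f.mulVec (Pi.single j 1)) (by rw [Matrix.mulVec_mulVec, h3, Matrix.zero_mulVec])
    by_cases hd : IsUnit (c * f₀).det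
    · have h : ∃ f : Matrix ι (Fin m) ℂ, H w * f = 0 ∧ c * f = 1 :=
        ⟨f₀ * (c * f₀)⁻¹, by rw [← Matrix.mul_assoc, hf1, Matrix.zero_mul], by
          rw [← Matrix.mul_assoc, Matrix.mul_nonsing_inv _ hd]⟩
      simp only [g, dif_pos h]
      obtain ⟨h3, h4⟩ := h.choose_spec
      set f := h.choose
      have h5 : f = f₀ * (c₀ * f) := hcoord f h3
      have h6 : c * f₀ * (c₀ * f) = 1 := by rw [Matrix.mul_assoc, ← h5, h4]
      rw [Matrix.inv_eq_right_inv h6, ← h5]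
    · have h : ¬ ∃ f : Matrix ι (Fin m) ℂ, H w * f = 0 ∧ c * f = 1 := by
        rintro ⟨f, h3, h4⟩
        have h5 : f = f₀ * (c₀ * f) := hcoord f h3
        have h6 : c * f₀ * (c₀ * f) = 1 := by rw [Matrix.mul_assoc, ← h5, h4]
        exact hd (Matrix.isUnit_det_of_right_inverse h6)
      simp only [g, dif_neg h]
      rw [Matrix.nonsing_inv_apply_not_isUnit _ hd, Matrix.mul_zero]
  have hHc : ∀ w, ContinuousAt H w := fun w =>
    continuousAt_pi.2 fun a => continuousAt_pi.2 fun b => (hH a b).continuous.continuousAt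
  have hmero : ∀ a b w, MeromorphicAt (fun z => g z a b) w := by
    intro a b w
    obtain ⟨c₀, e₀, R₀, h1, h2, h3⟩ := exists_normalized_complement (H w) (hker w)
    have hev : ∀ᶠ z in 𝓝 w, (e₀ * c₀ + R₀ * H z).det ≠ 0 := by
      have : ContinuousAt (fun z => (e₀ * c₀ + R₀ * H z).det) w := by
        have h4 : Continuous fun A : Matrix ι ι ℂ => (e₀ * c₀ + R₀ * A).det := by fun_prop
        exact h4.continuousAt.comp (hHc w)
      exact this.eventually_ne (by rw [h3]; simp)
    set f₀ : ℂ → Matrix ι (Fin m) ℂ := fun z => (e₀ * c₀ + R₀ * H z)⁻¹ * e₀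
    have hf₀ : ∀ᶠ z in 𝓝 w, ∀ a b, DifferentiableAt ℂ (fun z => f₀ z a b) z :=
      hev.mono fun z hz a b => differentiableAt_frame hH hker hdbar h1 h2 hz a b
    have hana : ∀ F : ℂ → ℂ, (∀ᶠ z in 𝓝 w, DifferentiableAt ℂ F z) → MeromorphicAt F w :=
      fun F hF => (Complex.analyticAt_iff_eventually_differentiableAt.2 hF).meromorphicAt
    have hcf : ∀ᶠ z in 𝓝 w, ∀ a b, DifferentiableAt ℂ (fun z => (c * f₀ z) a b) z :=
      hf₀.mono fun z hz => differentiableAt_matrix_mul (fun _ _ => differentiableAt_const _) hz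
    have hm : MeromorphicAt (fun z => ∑ i, f₀ z a i *
        ((c * f₀ z).det⁻¹ * (c * f₀ z).adjugate i b)) w := by
      refine MeromorphicAt.fun_sum fun i _ => ?_
      refine (hana _ (hf₀.mono fun z hz => hz a i)).fun_mul (MeromorphicAt.fun_mul ?_ ?_)
      · exact (hana _ (hcf.mono fun z hz => differentiableAt_det hz)).fun_inv
      · exact hana _ (hcf.mono fun z hz => differentiableAt_adjugate hz i b)
    refine hm.congr (Filter.EventuallyEq.filter_mono ?_ nhdsWithin_le_nhds)
    filter_upwards [hev] with z hz
    rw [hchart h1 h2 hz, Matrix.mul_apply]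
    simp [Matrix.inv_def, f₀]
  have hZlim : Tendsto (fun w => e * c + R * H w) (cocompact ℂ) (𝓝 1) := by
    have h4 : Continuous fun A : Matrix ι ι ℂ => e * c + R * A := by fun_prop
    rw [← hZ]
    exact (h4.tendsto _).comp hlim
  have hdet : ∀ᶠ w in cocompact ℂ, (e * c + R * H w).det ≠ 0 := by
    have h4 : Tendsto (fun w => (e * c + R * H w).det) (cocompact ℂ) (𝓝 1) := by
      rw [← Matrix.det_one (n := ι)]
      exact (continuous_id.matrix_det.tendsto (1 : Matrix ι ι ℂ)).comp hZlim
    exact h4.eventually_ne one_ne_zero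
  have hginf : ∀ᶠ w in cocompact ℂ, g w = (e * c + R * H w)⁻¹ * e ∧ c * g w = 1 ∧
      ∀ a b, ‖g w a b‖ ≤ ‖e a b‖ + 1 := by
    have h5 : Tendsto (fun w => (e * c + R * H w)⁻¹ * e) (cocompact ℂ) (𝓝 e) := by
      have h6 : ContinuousAt (fun Z : Matrix ι ι ℂ => Z⁻¹ * e) 1 := by
        have h7 : Continuous fun Z : Matrix ι ι ℂ => Z * e := by fun_prop
        exact h7.continuousAt.comp (continuousAt_inv_matrix (by simp))
      have := h6.tendsto.comp hZlim
      rwa [inv_one, Matrix.one_mul] at this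
    have h8 : ∀ a b, ∀ᶠ w in cocompact ℂ,
        ‖((e * c + R * H w)⁻¹ * e) a b‖ ≤ ‖e a b‖ + 1 := by
      intro a b
      have h9 := ((tendsto_pi_nhds.1 (tendsto_pi_nhds.1 h5 a) b)).norm
      exact (h9.eventually_lt_const (lt_add_one _)).mono fun _ h => h.le
    filter_upwards [hdet, eventually_all.2 fun a => eventually_all.2 (h8 a)] with w hw hb
    obtain ⟨-, hf2, -⟩ := frame_spec (hker w) hce hcR (isUnit_iff_ne_zero.2 hw)
    have h9 : g w = (e * c + R * H w)⁻¹ * e := by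
      rw [hchart hce hcR hw, hf2, inv_one, Matrix.mul_one]
    exact ⟨h9, by rw [h9, hf2], by rw [h9]; exact hb⟩
  obtain ⟨ρ, hρ⟩ : ∃ ρ : ℝ, ∀ w : ℂ, ρ < ‖w‖ → (e * c + R * H w).det ≠ 0 ∧
      g w = (e * c + R * H w)⁻¹ * e ∧ c * g w = 1 ∧ ∀ a b, ‖g w a b‖ ≤ ‖e a b‖ + 1 := by
    have := hdet.and hginf
    rw [← Metric.cobounded_eq_cocompact, ← comap_norm_atTop] at this
    obtain ⟨t, ht, hts⟩ := (Filter.eventually_comap.1 this).exists_mem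
    obtain ⟨ρ, hρ⟩ := mem_atTop_sets.1 ht
    exact ⟨ρ, fun w hw => hts _ (hρ _ hw.le) w rfl⟩
  have hrat : ∀ a b, ∃ p q : ℂ[X], q ≠ 0 ∧ ∀ z, q.eval z * g z a b = p.eval z := by
    intro a b
    refine exists_rational_of_meromorphic (hmero a b) ρ (‖e a b‖ + 1) (fun z hz => ?_)
      (fun z hz => (hρ z hz).2.2.2 a b)
    have hev : ∀ᶠ z in 𝓝 z, (fun z => ((e * c + R * H z)⁻¹ * e) a b) z = g z a b := by
      filter_upwards [(isOpen_lt continuous_const continuous_norm).mem_nhds hz] with y hy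
      rw [(hρ y hy).2.1]
    exact (differentiableAt_frame hH hker hdbar hce hcR (hρ z hz).1 a b).congr_of_eventuallyEq
      (hev.mono fun y hy => hy.symm)
  choose p q hq hpq using hrat
  let Q : ℂ[X] := ∏ a, ∏ b, q a b
  -- `Q` is a common denominator of all entries; multiplying `g` by it gives the polynomial frame.
  have hQ : Q ≠ 0 := Finset.prod_ne_zero_iff.2 fun a _ => Finset.prod_ne_zero_iff.2 fun b _ => hq a b
  have hdvd : ∀ a b, q a b ∣ Q := fun a b =>
    (Finset.dvd_prod_of_mem (fun b => q a b) (Finset.mem_univ b)).trans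
      (Finset.dvd_prod_of_mem (fun a => ∏ b, q a b) (Finset.mem_univ a))
  choose r hr using hdvd
  let p' : Matrix ι (Fin m) ℂ[X] := Matrix.of fun a b => r a b * p a b
  have hp' : ∀ w, p'.map (eval w) = Q.eval w • g w := by
    intro w
    ext a b
    simp only [p', Matrix.map_apply, Matrix.of_apply, eval_mul, Matrix.smul_apply, smul_eq_mul]
    rw [← hpq, hr a b, eval_mul]
    ring
  refine ⟨c, p', Q, hQ, fun w => by rw [hp', Matrix.mul_smul, hHg, smul_zero], ?_⟩
  ext a b : 1
  -- `c g = 1` is known only near infinity, which suffices for an identity between polynomials.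
  refine Polynomial.eq_of_infinite_eval_eq _ _ ?_
  refine Set.Infinite.mono (s := {w | ρ < ‖w‖}) (fun w hw => ?_) ?_
  · have h : (c * p'.map (eval w)) a b = (Q.eval w • (1 : Matrix (Fin m) (Fin m) ℂ)) a b := by
      rw [hp', Matrix.mul_smul, (hρ w hw).2.2.1]
    simp only [Set.mem_ofPred_eq, Matrix.mul_apply, Matrix.map_apply, eval_finsetSum, eval_mul,
      eval_C, Matrix.smul_apply, smul_eq_mul, Matrix.one_apply] at h ⊢
    rw [h]
    split_ifs <;> simp
  · refine Set.infinite_of_not_bddAbove (α := ℝ) ?_ |>.of_image norm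
    rintro ⟨M, hM⟩
    have : ((max M ρ + 1 : ℝ) : ℂ) ∈ {w : ℂ | ρ < ‖w‖} := by
      rw [Set.mem_ofPred_eq, Complex.norm_real]
      exact lt_of_lt_of_le (by linarith [le_max_right M ρ]) (le_abs_self _)
    have h2 := hM ⟨_, this, rfl⟩
    rw [Complex.norm_real] at h2
    linarith [le_max_left M ρ, (le_abs_self _).trans h2]

end Frame

/-! ### Action on Laurent series and orders of poles -/

section Algebra

variable {n : ℕ}

theorem P_zero_right (π : ℕ → Mat n) (m : ℕ) : P π m 0 = 1 := by
  simp [P]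

theorem P_eq_zero (π : ℕ → Mat n) {m j : ℕ} (h : m < j) : P π m j = 0 := by
  rw [P, Finset.powersetCard_eq_empty.2 (by simpa using h), Finset.sum_empty]

/-- The index sets are split according to whether they contain `m + 1`; since the indices decrease,
its factor stands leftmost. -/
theorem P_succ_succ (π : ℕ → Mat n) (m j : ℕ) :
    P π (m + 1) (j + 1) = P π m (j + 1) + perp (π (m + 1)) * P π m j := by
  have hnot : m + 1 ∉ Finset.Icc 1 m := by simp
  have hmem : ∀ {i} {s : Finset ℕ}, s ∈ Finset.powersetCard i (Finset.Icc 1 m) → m + 1 ∉ s :=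
    fun hs h => hnot ((Finset.mem_powersetCard.1 hs).1 h)
  rw [P, ← Finset.insert_Icc_right_eq_Icc_add_one (by omega),
    Finset.powersetCard_succ_insert hnot, Finset.sum_union, Finset.sum_image]
  · congr 1
    rw [P, Finset.mul_sum]
    refine Finset.sum_congr rfl fun s hs => ?_
    rw [Finset.sort_insert (r := fun a b => b ≤ a), List.map_cons, List.prod_cons]
    · intro b hb
      have := Finset.mem_Icc.1 ((Finset.mem_powersetCard.1 hs).1 hb)
      omega
    · exact hmem hs
  · intro s hs t ht hst
    rw [← Finset.erase_insert (hmem hs), ← Finset.erase_insert (hmem ht)]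
    exact congrArg (fun u => Finset.erase u (m + 1)) hst
  · rw [Finset.disjoint_left]
    intro s hs hs'
    obtain ⟨t, -, rfl⟩ := Finset.mem_image.1 hs'
    exact hmem hs (Finset.mem_insert_self _ _)

/-- Vanishing of the coefficients below `M`. -/
def regular (M : ℤ) : Submodule ℂ (ℤ → Vec n) where
  carrier := {x | ∀ q < M, x q = 0}
  add_mem' hx hy q hq := by simp [hx q hq, hy q hq]
  zero_mem' q _ := rfl
  smul_mem' c x hx q hq := by simp [hx q hq]

theorem regular_anti {M N : ℤ} (h : M ≤ N) : regular (n := n) N ≤ regular M :=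
  fun _ hx q hq => hx q (hq.trans_le h)

/-- The action of `1 + 2i (l - i)⁻¹ T^⊥` on the coefficients of a Laurent series in `l - i`. -/
def simpleAct (T : Mat n) : (ℤ → Vec n) →ₗ[ℂ] (ℤ → Vec n) where
  toFun x q := x q + (2 * Complex.I) • (perp T).mulVec (x (q + 1))
  map_add' x y := by
    funext q
    simp only [Pi.add_apply, Matrix.mulVec_add, smul_add]
    abel
  map_smul' c x := by
    funext q
    simp only [Pi.smul_apply, Matrix.mulVec_smul, smul_add, RingHom.id_apply]
    rw [smul_comm]

theorem simpleAct_apply (T : Mat n) (x : ℤ → Vec n) (q : ℤ) :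
    simpleAct T x q = x q + (2 * Complex.I) • (perp T).mulVec (x (q + 1)) := rfl

/-- The action of `g_{i, π_p} ⋯ g_{i, π_1}` on the coefficients of a Laurent series in `l - i`. -/
def prodAct (π : ℕ → Mat n) : ℕ → (ℤ → Vec n) →ₗ[ℂ] (ℤ → Vec n)
  | 0 => LinearMap.id
  | p + 1 => simpleAct (π (p + 1)) ∘ₗ prodAct π p

theorem prodAct_succ (π : ℕ → Mat n) (p : ℕ) (x : ℤ → Vec n) :
    prodAct π (p + 1) x = simpleAct (π (p + 1)) (prodAct π p x) := rfl

theorem prodAct_apply (π : ℕ → Mat n) (p : ℕ) (x : ℤ → Vec n) (q : ℤ) :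
    prodAct π p x q = ∑ j ∈ Finset.range (p + 1),
      ((2 * Complex.I) ^ j) • (P π p j).mulVec (x (q + j)) := by
  induction p generalizing q with
  | zero => simp [prodAct, P_zero_right]
  | succ p ih =>
    rw [prodAct_succ, simpleAct_apply, ih, ih, Finset.sum_range_succ' _ (p + 1)]
    simp only [P_succ_succ, P_zero_right, Matrix.add_mulVec, smul_add, Finset.sum_add_distrib]
    rw [Finset.sum_range_succ (fun j => (2 * Complex.I) ^ (j + 1) •
      (P π p (j + 1)).mulVec (x (q + (j + 1 : ℕ)))) p, P_eq_zero π (Nat.lt_succ_self p),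
      Matrix.zero_mulVec, smul_zero, add_zero, Finset.sum_range_succ' _ p, P_zero_right,
      Matrix.mulVec_sum, Finset.smul_sum]
    have : ∀ j : ℕ, (2 * Complex.I) • (perp (π (p + 1))).mulVec ((2 * Complex.I) ^ j •
        (P π p j).mulVec (x (q + 1 + j))) = (2 * Complex.I) ^ (j + 1) •
        (perp (π (p + 1)) * P π p j).mulVec (x (q + (j + 1 : ℕ))) := by
      intro j
      rw [Matrix.mulVec_smul, smul_smul, Matrix.mulVec_mulVec, pow_succ']
      congr 3
      push_cast
      ring
    simp only [this]
    abel

theorem mem_im_iff {T : Mat n} (hT : T * T = T) {x : Vec n} : x ∈ im T ↔ T.mulVec x = x := by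
  constructor
  · rintro ⟨y, rfl⟩
    simp [Matrix.mulVec_mulVec, hT]
  · intro h
    exact ⟨x, h⟩

theorem mem_im_iff_perp {T : Mat n} (hT : T * T = T) {x : Vec n} :
    x ∈ im T ↔ (perp T).mulVec x = 0 := by
  rw [mem_im_iff hT, perp, Matrix.sub_mulVec, Matrix.one_mulVec, sub_eq_zero, eq_comm]

theorem perp_mul_self {T : Mat n} (hT : T * T = T) : perp T * perp T = perp T := by
  rw [perp, sub_mul, one_mul, mul_sub, mul_one, hT, sub_self, sub_zero]

theorem mul_perp {T : Mat n} (hT : T * T = T) : T * perp T = 0 := by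
  rw [perp, mul_sub, mul_one, hT, sub_self]

theorem perp_mul {T : Mat n} (hT : T * T = T) : perp T * T = 0 := by
  rw [perp, sub_mul, one_mul, hT, sub_self]

theorem mulVec_add_perp_mulVec (T : Mat n) (x : Vec n) : T.mulVec x + (perp T).mulVec x = x := by
  rw [← Matrix.add_mulVec, perp, add_sub_cancel, Matrix.one_mulVec]

theorem finrank_im_perp {T : Mat n} (hT : T * T = T) :
    Module.finrank ℂ (im (perp T)) = n - Module.finrank ℂ (im T) := by
  have h1 : LinearMap.ker T.mulVecLin = im (perp T) := by
    ext x
    rw [mem_im_iff (perp_mul_self hT), LinearMap.mem_ker, Matrix.mulVecLin_apply, perp,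
      Matrix.sub_mulVec, Matrix.one_mulVec, sub_eq_self]
  have h2 : Module.finrank ℂ (im T) + Module.finrank ℂ (im (perp T)) = n := by
    rw [← h1, im, LinearMap.finrank_range_add_finrank_ker, Module.finrank_fin_fun]
  omega

theorem regular_simpleAct (T : Mat n) {M : ℤ} {x : ℤ → Vec n} (hx : x ∈ regular M) :
    simpleAct T x ∈ regular (M - 1) := by
  intro q hq
  rw [simpleAct_apply, hx q (by omega), hx (q + 1) (by omega)]
  simp

theorem regular_prodAct (π : ℕ → Mat n) (p : ℕ) {M : ℤ} {x : ℤ → Vec n} (hx : x ∈ regular M) :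
    prodAct π p x ∈ regular (M - p) := by
  induction p with
  | zero => simpa [prodAct] using hx
  | succ p ih =>
    rw [prodAct_succ]
    convert! regular_simpleAct _ ih using 2
    push_cast
    ring

/-- The inverse of a simple factor has no pole at `i`. On coefficients: if everything below `x q`
vanishes, degree `q - 1` of the image gives `T^⊥ (x q) = 0`, and `T` applied to degree `q` gives `T
(x q) = 0`. The hypothesis with `R` only starts this induction. -/
theorem regular_of_simpleAct {T : Mat n} (hT : T * T = T) {R M : ℤ} {x : ℤ → Vec n}
    (hR : x ∈ regular R) (h : simpleAct T x ∈ regular M) : x ∈ regular M := by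
  have key : ∀ d : ℕ, R + d ≤ M → x ∈ regular (R + d) := by
    intro d
    induction d with
    | zero => simpa using fun _ => hR
    | succ d ih =>
      intro hd q hq
      push_cast at hd hq
      have ih := ih (by omega)
      rcases lt_or_ge q (R + d) with h1 | h1
      · exact ih q h1
      · obtain rfl : q = R + d := by omega
        have h2 := h (R + d - 1) (by omega)
        rw [simpleAct_apply, ih _ (by omega), zero_add, smul_eq_zero_iff_right (by simp),
          sub_add_cancel] at h2
        have h3 := congrArg T.mulVec (h (R + d) (by omega))
        rw [simpleAct_apply, Matrix.mulVec_add, Matrix.mulVec_smul, Matrix.mulVec_mulVec,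
          mul_perp hT, Matrix.zero_mulVec, Matrix.mulVec_zero, smul_zero, add_zero] at h3
        rw [← mulVec_add_perp_mulVec T (x (R + d)), h2, h3, add_zero]
  rcases le_or_gt M R with h1 | h1
  · exact regular_anti h1 hR
  · have := key (M - R).toNat (by omega)
    rwa [show R + ((M - R).toNat : ℤ) = M by omega] at this

variable {π : ℕ → Mat n} {k : ℕ}

theorem regular_prodAct_of_le (hπ : ∀ j ∈ Finset.Icc 1 k, π j * π j = π j) {p r : ℕ} (hr : r ≤ k)
    (hp : p ≤ r) {R M : ℤ} {x : ℤ → Vec n} (hR : x ∈ regular R) (h : prodAct π r x ∈ regular M) :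
    prodAct π p x ∈ regular M := by
  induction r with
  | zero =>
    obtain rfl : p = 0 := by omega
    exact h
  | succ r ih =>
    rcases eq_or_lt_of_le hp with rfl | h1
    · exact h
    · refine ih (by omega) (by omega) ?_
      exact regular_of_simpleAct (hπ _ (by simp; omega)) (regular_prodAct π r hR) h

/-- The one coefficient that the new factor can push below degree `M` is `2i π_{p+1}^⊥` applied to
the coefficient of degree `M`. -/
theorem regular_prodAct_succ_iff (hT : ∀ j ∈ Finset.Icc 1 k, π j * π j = π j) {p : ℕ} (hp : p < k)
    {R : ℤ} {x : ℤ → Vec n} (hR : x ∈ regular R) (M : ℤ) :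
    prodAct π (p + 1) x ∈ regular M ↔
      prodAct π p x ∈ regular M ∧ (perp (π (p + 1))).mulVec (prodAct π p x M) = 0 := by
  constructor
  · intro h
    have h1 := regular_prodAct_of_le hT (by omega) (Nat.le_succ p) hR h
    refine ⟨h1, ?_⟩
    have h2 := h (M - 1) (by omega)
    rwa [prodAct_succ, simpleAct_apply, h1 _ (by omega), zero_add,
      smul_eq_zero_iff_right (by simp), sub_add_cancel] at h2
  · rintro ⟨h1, h2⟩ q hq
    rw [prodAct_succ, simpleAct_apply, h1 _ hq, zero_add]
    rcases eq_or_lt_of_le (show q + 1 ≤ M by omega) with h3 | h3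
    · rw [h3, h2, smul_zero]
    · rw [h1 _ h3, Matrix.mulVec_zero, smul_zero]

/-- Solved degree by degree: the `T` part of `x` in degree `q` is that of `b`, and the `T^⊥` part is
determined by degree `q - 1`. -/
theorem exists_simpleAct_eq {T : Mat n} (hT : T * T = T) {b : ℤ → Vec n} (hb : b ∈ regular 0) :
    ∃ x ∈ regular 0, simpleAct T x = b := by
  let y : ℕ → Vec n := fun j => Nat.rec (T.mulVec (b 0)) (fun j v =>
    T.mulVec (b (j + 1)) + (2 * Complex.I)⁻¹ • (perp T).mulVec (b j - v)) j
  have hy : ∀ j : ℕ, (perp T).mulVec (y (j + 1)) =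
      (2 * Complex.I)⁻¹ • (perp T).mulVec (b j - y j) := by
    intro j
    change (perp T).mulVec (T.mulVec (b (j + 1)) +
      (2 * Complex.I)⁻¹ • (perp T).mulVec (b j - y j)) = _
    rw [Matrix.mulVec_add, Matrix.mulVec_mulVec, perp_mul hT, Matrix.zero_mulVec, zero_add,
      Matrix.mulVec_smul, Matrix.mulVec_mulVec, perp_mul_self hT]
  have hy' : ∀ j : ℕ, T.mulVec (y j) = T.mulVec (b j) := by
    rintro (_ | j)
    · change T.mulVec (T.mulVec (b 0)) = _
      simp [Matrix.mulVec_mulVec, hT]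
    · change T.mulVec (T.mulVec (b (j + 1)) +
        (2 * Complex.I)⁻¹ • (perp T).mulVec (b j - y j)) = _
      rw [Matrix.mulVec_add, Matrix.mulVec_mulVec, hT, Matrix.mulVec_smul, Matrix.mulVec_mulVec,
        mul_perp hT, Matrix.zero_mulVec, smul_zero, add_zero]
      simp
  refine ⟨fun q => if 0 ≤ q then y q.toNat else 0, fun q hq => if_neg (by omega), ?_⟩
  funext q
  rw [simpleAct_apply]
  rcases lt_trichotomy q (-1) with h | h | h
  · rw [if_neg (by omega), if_neg (by omega), hb q (by omega)]
    simp
  · subst h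
    rw [if_neg (by omega), if_pos (by omega), hb _ (by omega)]
    change 0 + (2 * Complex.I) • (perp T).mulVec (T.mulVec (b 0)) = 0
    rw [Matrix.mulVec_mulVec, perp_mul hT]
    simp
  · obtain ⟨j, rfl⟩ := Int.eq_ofNat_of_zero_le (show 0 ≤ q by omega)
    rw [if_pos (by omega), if_pos (by omega)]
    rw [show ((j : ℤ) + 1).toNat = j + 1 by omega, Int.toNat_natCast, hy, smul_smul,
      mul_inv_cancel₀ (by simp), one_smul, Matrix.mulVec_sub]
    nth_rewrite 1 [← mulVec_add_perp_mulVec T (y j)]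
    rw [hy', add_add_sub_cancel, mulVec_add_perp_mulVec]

theorem exists_prodAct_eq (hπ : ∀ j ∈ Finset.Icc 1 k, π j * π j = π j) {p : ℕ} (hp : p ≤ k)
    {b : ℤ → Vec n} (hb : b ∈ regular 0) : ∃ x ∈ regular 0, prodAct π p x = b := by
  induction p generalizing b with
  | zero => exact ⟨b, hb, rfl⟩
  | succ p ih =>
    obtain ⟨c, hc, rfl⟩ := exists_simpleAct_eq (hπ (p + 1) (by simp; omega)) hb
    obtain ⟨x, hx, rfl⟩ := ih (by omega) hc
    exact ⟨x, hx, rfl⟩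

/-- The shift of a Laurent series. -/
def shift (s : ℤ) (x : ℤ → Vec n) : ℤ → Vec n := fun q => x (q + s)

theorem shift_mem_regular {s M : ℤ} {x : ℤ → Vec n} :
    shift s x ∈ regular M ↔ x ∈ regular (M + s) := by
  constructor
  · intro h q hq
    simpa [shift] using h (q - s) (by omega)
  · intro h q hq
    exact h (q + s) (by omega)

theorem prodAct_shift (π : ℕ → Mat n) (p : ℕ) (s : ℤ) (x : ℤ → Vec n) :
    prodAct π p (shift s x) = shift s (prodAct π p x) := by
  funext q
  simp only [prodAct_apply, shift]
  refine Finset.sum_congr rfl fun j _ => ?_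
  rw [show q + (j : ℤ) + s = q + s + j by ring]

/-- Under transversality, a pole of order at most one of `φ_p x` disappears in `φ_{p-1} x`. -/
theorem regular_prodAct_of_simple_pole (hπ : ∀ j ∈ Finset.Icc 1 k, π j * π j = π j)
    (htr : ∀ j ∈ Finset.Icc 2 k, im (π j) ⊓ im (perp (π (j - 1))) = ⊥) {p : ℕ} (hp : p < k)
    {x : ℤ → Vec n} (hx : x ∈ regular 0) (h : prodAct π (p + 1) x ∈ regular (-1)) :
    prodAct π p x ∈ regular 0 := by
  induction p with
  | zero => exact hx
  | succ p ih =>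
    obtain ⟨h1, h2⟩ := (regular_prodAct_succ_iff hπ hp hx _).1 h
    have h3 := ih (by omega) h1
    -- The residue lies in `Im π_{p+2}` because the next factor does not deepen the pole, and in `Im
    -- π_{p+1}^⊥` because the last factor created it.
    have h4 : prodAct π (p + 1) x (-1) = 0 := by
      have h5 : prodAct π (p + 1) x (-1) ∈ im (π (p + 2)) ⊓ im (perp (π (p + 1))) := by
        refine ⟨(mem_im_iff_perp (hπ _ (by simp; omega))).2 h2, ?_⟩
        rw [prodAct_succ, simpleAct_apply, h3 (-1) (by omega), zero_add]
        exact Submodule.smul_mem _ _ ⟨_, rfl⟩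
      exact (htr (p + 2) (by simp; omega)).le h5
    intro q hq
    rcases eq_or_lt_of_le (show q ≤ -1 by omega) with rfl | h6
    · exact h4
    · exact h1 q h6

/-- Multiplying `x` by a power of `l - i` turns a pole of higher order into a simple one, so each
dropped factor lowers the order by one. -/
theorem regular_prodAct_of_pole (hπ : ∀ j ∈ Finset.Icc 1 k, π j * π j = π j)
    (htr : ∀ j ∈ Finset.Icc 2 k, im (π j) ⊓ im (perp (π (j - 1))) = ⊥) (d : ℕ) {p : ℕ}
    (hp : p + d ≤ k) {x : ℤ → Vec n} (hx : x ∈ regular 0)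
    (h : prodAct π (p + d) x ∈ regular (-d)) : prodAct π p x ∈ regular 0 := by
  induction d with
  | zero => simpa using h
  | succ d ih =>
    refine ih (by omega) ?_
    have h1 : shift (-d) x ∈ regular 0 := shift_mem_regular.2 (regular_anti (by omega) hx)
    have h2 := regular_prodAct_of_simple_pole hπ htr (p := p + d) (by omega) h1 (by
      rw [prodAct_shift, shift_mem_regular]
      convert! h using 2
      push_cast
      ring)
    rw [prodAct_shift, shift_mem_regular] at h2
    simpa using h2

/-- The Laurent polynomial with the given `k` coefficients. -/
def ext (k : ℕ) : (Fin k × Fin n → ℂ) →ₗ[ℂ] (ℤ → Vec n) where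
  toFun x q l := if h : 0 ≤ q ∧ q < k then x (⟨q.toNat, by omega⟩, l) else 0
  map_add' x y := by
    funext q l
    by_cases h : 0 ≤ q ∧ q < k <;> simp [h]
  map_smul' c x := by
    funext q l
    by_cases h : 0 ≤ q ∧ q < k <;> simp [h]

theorem ext_natCast (x : Fin k × Fin n → ℂ) (j : Fin k) (l : Fin n) :
    ext k x (j : ℕ) l = x (j, l) := by
  have : (0 : ℤ) ≤ (j : ℕ) ∧ ((j : ℕ) : ℤ) < k := by omega
  simp [ext, this]

theorem ext_regular (x : Fin k × Fin n → ℂ) : ext k x ∈ regular 0 := by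
  intro q hq
  funext l
  have : ¬ (0 ≤ q ∧ q < k) := by omega
  simp [ext, this]

theorem sub_ext_regular {x : ℤ → Vec n} (hx : x ∈ regular 0) :
    x - ext k (fun i => x (i.1 : ℕ) i.2) ∈ regular k := by
  intro q hq
  funext l
  rw [Pi.sub_apply, Pi.sub_apply, Pi.zero_apply, sub_eq_zero]
  by_cases h : 0 ≤ q
  · obtain ⟨j, rfl⟩ := Int.eq_ofNat_of_zero_le h
    rw [ext_natCast _ ⟨j, by omega⟩ l]
  · rw [ext_regular _ q (by omega), hx q (by omega)]

/-- The fibre at a point of the Grassmannian model of `g_{i, π_p} ⋯ g_{i, π_1}`. -/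
def fibre (π : ℕ → Mat n) (k p : ℕ) : Submodule ℂ (Fin k × Fin n → ℂ) :=
  (regular 0).comap (prodAct π p ∘ₗ ext k)

theorem mem_fibre {p : ℕ} {x : Fin k × Fin n → ℂ} :
    x ∈ fibre π k p ↔ prodAct π p (ext k x) ∈ regular 0 := Iff.rfl

theorem mem_fibre_succ (hπ : ∀ j ∈ Finset.Icc 1 k, π j * π j = π j) {p : ℕ} (hp : p < k)
    {x : Fin k × Fin n → ℂ} : x ∈ fibre π k (p + 1) ↔
      x ∈ fibre π k p ∧ prodAct π p (ext k x) 0 ∈ im (π (p + 1)) := by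
  rw [mem_fibre, regular_prodAct_succ_iff hπ hp (ext_regular x),
    mem_im_iff_perp (hπ _ (by simp; omega)), mem_fibre]

/-- The constant series `u` is pulled back through `φ_p` and truncated modulo `(l - i)^k`. The error
is mapped to order at least `k - p > 0`, so it is invisible in degrees up to `0`. -/
theorem exists_mem_fibre (hπ : ∀ j ∈ Finset.Icc 1 k, π j * π j = π j) {p : ℕ} (hp : p < k)
    (u : Vec n) : ∃ x ∈ fibre π k p, prodAct π p (ext k x) 0 = u := by
  obtain ⟨y, hy, hy'⟩ := exists_prodAct_eq hπ hp.le (b := fun q => if q = 0 then u else 0)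
    (fun q hq => if_neg hq.ne)
  have h := regular_prodAct π p (sub_ext_regular (k := k) hy)
  rw [map_sub, hy'] at h
  have h' : ∀ q ≤ 0, prodAct π p (ext k (fun i : Fin k × Fin n => y (i.1 : ℕ) i.2)) q =
      if q = 0 then u else 0 := fun q hq => (sub_eq_zero.1 (h q (by omega))).symm
  exact ⟨_, fun q hq => (h' q hq.le).trans (if_neg hq.ne), by rw [h' 0 le_rfl, if_pos rfl]⟩

/-- Passing from `p` to `p + 1` imposes `π_{p+1}^⊥ v = 0` on the constant term `v` of `φ_p x`. As
`v` takes every value on the fibre, this costs `n - rk π_{p+1}` dimensions. Transversality plays no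
role, so the count also applies to limits of the projections. -/
theorem finrank_fibre (hπ : ∀ j ∈ Finset.Icc 1 k, π j * π j = π j) {p : ℕ} (hp : p ≤ k) :
    Module.finrank ℂ (fibre π k p) =
      k * n - ∑ j ∈ Finset.range p, (n - Module.finrank ℂ (im (π (j + 1)))) := by
  induction p with
  | zero =>
    have : fibre π k 0 = ⊤ := eq_top_iff.2 fun x _ => ext_regular x
    rw [this, finrank_top]
    simp
  | succ p ih =>
    have hp1 : π (p + 1) * π (p + 1) = π (p + 1) := hπ _ (by simp; omega)
    let v : fibre π k p →ₗ[ℂ] Vec n := (perp (π (p + 1))).mulVecLin ∘ₗ LinearMap.proj 0 ∘ₗ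
      prodAct π p ∘ₗ ext k ∘ₗ (fibre π k p).subtype
    have hv : ∀ x, v x = (perp (π (p + 1))).mulVec (prodAct π p (ext k x) 0) := fun _ => rfl
    have h1 : LinearMap.range v = im (perp (π (p + 1))) := by
      apply le_antisymm
      · rintro _ ⟨x, rfl⟩
        exact ⟨_, rfl⟩
      · rintro _ ⟨u, rfl⟩
        obtain ⟨x, hx, rfl⟩ := exists_mem_fibre (k := k) (p := p) hπ (by omega) u
        exact ⟨⟨x, hx⟩, rfl⟩
    have h2 : (LinearMap.ker v).map (fibre π k p).subtype = fibre π k (p + 1) := by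
      ext x
      rw [mem_fibre_succ hπ (by omega), mem_im_iff_perp hp1]
      constructor
      · rintro ⟨x, hx, rfl⟩
        exact ⟨x.2, hx⟩
      · rintro ⟨hx, hx'⟩
        exact ⟨⟨x, hx⟩, hx', rfl⟩
    have h3 := LinearMap.finrank_range_add_finrank_ker v
    rw [h1, finrank_im_perp hp1, ← Submodule.finrank_map_subtype_eq, h2] at h3
    rw [Finset.sum_range_succ]
    have := ih (by omega)
    omega

end Algebra

/-! ### The fibre as the kernel of a Hankel matrix -/

section Hankel

variable {n : ℕ} {π : ℕ → Mat n} {k : ℕ}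

/-- If `φ_{k-1} x` has order at least `1`, so has `x`, since the inverse factors have no pole.
Conversely, if `a_0 = 0`, then `φ_k` has at most a simple pole on `x / (l - i)`, and transversality
makes `φ_{k-1}` regular there. -/
theorem prodAct_ext_eq_zero_iff (hπ : ∀ j ∈ Finset.Icc 1 k, π j * π j = π j)
    (htr : ∀ j ∈ Finset.Icc 2 k, im (π j) ⊓ im (perp (π (j - 1))) = ⊥) (hk : 1 ≤ k)
    {x : Fin k × Fin n → ℂ} (hx : x ∈ fibre π k k) :
    prodAct π (k - 1) (ext k x) 0 = 0 ↔ ext k x 0 = 0 := by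
  obtain ⟨p, rfl⟩ := Nat.exists_eq_add_of_le' hk
  have reg_one : ∀ {y : ℤ → Vec n}, y ∈ regular 0 → y 0 = 0 → y ∈ regular 1 := by
    intro y hy hy0 q hq
    rcases eq_or_lt_of_le (show q ≤ 0 by omega) with rfl | h
    · exact hy0
    · exact hy q h
  constructor
  · intro h
    have h1 : prodAct π p (ext (p + 1) x) ∈ regular 0 := ((mem_fibre_succ hπ (by omega)).1 hx).1
    exact regular_prodAct_of_le hπ (r := p) (p := 0) (by omega) (by omega) (ext_regular x)
      (reg_one h1 h) 0 (by omega)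
  · intro h
    have h1 : shift 1 (ext (p + 1) x) ∈ regular 0 :=
      shift_mem_regular.2 (reg_one (ext_regular x) h)
    have h2 := regular_prodAct_of_simple_pole hπ htr (p := p) (by omega) h1 (by
      rw [prodAct_shift, shift_mem_regular]
      exact hx)
    rw [prodAct_shift, shift_mem_regular] at h2
    exact h2 0 (by omega)

/-- The coefficient of `(l - i)^{-j}` in `g_{i, π_k} ⋯ g_{i, π_1}`. -/
noncomputable def coef (π : ℕ → Mat n) (k j : ℕ) : Mat n := (2 * Complex.I) ^ j • P π k j

theorem coef_zero (π : ℕ → Mat n) (k : ℕ) : coef π k 0 = 1 := by simp [coef, P_zero_right]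

theorem coef_eq_zero (π : ℕ → Mat n) {k j : ℕ} (h : k < j) : coef π k j = 0 := by
  simp [coef, P_eq_zero π h]

theorem simpleProd_eq (π : ℕ → Mat n) (p : ℕ) {l : ℂ} (hl : l ≠ Complex.I) :
    simpleProd Complex.I π l p = ∑ j ∈ Finset.range (p + 1), (l - Complex.I)⁻¹ ^ j • coef π p j := by
  have hl' : l - Complex.I ≠ 0 := sub_ne_zero.2 hl
  have hg : ∀ T : Mat n, simpleElement Complex.I T l =
      1 + ((l - Complex.I)⁻¹ * (2 * Complex.I)) • perp T := by
    intro T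
    have h : (l - starRingEnd ℂ Complex.I) / (l - Complex.I) =
        1 + (l - Complex.I)⁻¹ * (2 * Complex.I) := by
      rw [Complex.conj_I]
      field_simp
      ring
    rw [simpleElement, h, add_smul, one_smul, ← add_assoc]
    simp [perp]
  induction p with
  | zero => simp [simpleProd, coef_zero]
  | succ p ih =>
    rw [simpleProd, ih, hg, add_mul, one_mul, Finset.sum_range_succ' _ (p + 1)]
    simp only [coef, P_succ_succ, P_zero_right, smul_add, Finset.sum_add_distrib]
    have h1 := Finset.sum_range_succ' (fun j => (l - Complex.I)⁻¹ ^ j • (2 * Complex.I) ^ j • P π p j) p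
    have h2 := Finset.sum_range_succ (fun j => (l - Complex.I)⁻¹ ^ (j + 1) •
      (2 * Complex.I) ^ (j + 1) • P π p (j + 1)) p
    rw [P_eq_zero π (Nat.lt_succ_self p), smul_zero, smul_zero, add_zero] at h2
    rw [Finset.mul_sum, h1, h2, P_zero_right]
    have : ∀ j : ℕ, ((l - Complex.I)⁻¹ * (2 * Complex.I)) • perp (π (p + 1)) *
        (l - Complex.I)⁻¹ ^ j • (2 * Complex.I) ^ j • P π p j =
        (l - Complex.I)⁻¹ ^ (j + 1) • (2 * Complex.I) ^ (j + 1) • (perp (π (p + 1)) * P π p j) := by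
      intro j
      simp only [Matrix.smul_mul, Matrix.mul_smul, smul_smul]
      congr 1
      ring
    simp only [this]
    abel

theorem prodAct_ext_neg (π : ℕ → Mat n) (x : Fin k × Fin n → ℂ) (q : ℕ) :
    prodAct π k (ext k x) (-(q + 1 : ℕ)) =
      ∑ l ∈ Finset.range k, (coef π k (q + l + 1)).mulVec (ext k x l) := by
  have h1 : prodAct π k (ext k x) (-(q + 1 : ℕ)) = ∑ j ∈ Finset.range ((q + 1) + k),
      (coef π k j).mulVec (ext k x (-(q + 1 : ℕ) + j)) := by
    rw [prodAct_apply]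
    simp only [← Matrix.smul_mulVec]
    refine Finset.sum_subset (Finset.range_subset_range.2 (by omega)) fun j _ hj => ?_
    rw [P_eq_zero π (by simpa using hj), smul_zero, Matrix.zero_mulVec]
  rw [h1, Finset.sum_range_add, Finset.sum_eq_zero, zero_add]
  · refine Finset.sum_congr rfl fun l _ => ?_
    rw [show -((q + 1 : ℕ) : ℤ) + ((q + 1 + l : ℕ) : ℤ) = l by omega,
      show q + 1 + l = q + l + 1 by omega]
  · intro j hj
    rw [ext_regular x _ (by simp at hj; omega), Matrix.mulVec_zero]

/-- The Hankel matrix of the coefficients `C_1, C_2, …`. -/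
def hankel (C : ℕ → Mat n) (k : ℕ) : Matrix (Fin k × Fin n) (Fin k × Fin n) ℂ :=
  Matrix.of fun i j => C (i.1 + j.1 + 1) i.2 j.2

theorem hankel_mulVec (C : ℕ → Mat n) (x : Fin k × Fin n → ℂ) (i : Fin k × Fin n) :
    (hankel C k).mulVec x i =
      (∑ l ∈ Finset.range k, (C (i.1 + l + 1)).mulVec (ext k x l)) i.2 := by
  rw [Finset.sum_range, Finset.sum_apply, Matrix.mulVec, dotProduct, Fintype.sum_prod_type]
  refine Finset.sum_congr rfl fun l _ => ?_
  rw [Matrix.mulVec, dotProduct]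
  exact Finset.sum_congr rfl fun b _ => by rw [ext_natCast]; rfl

/-- The rows are the coefficients of `φ_k x` in degrees `-1, …, -k`; below `-k` there are none,
because `φ_k` has a pole of order at most `k`. -/
theorem ker_hankel (π : ℕ → Mat n) (k : ℕ) : ker (hankel (coef π k) k) = fibre π k k := by
  ext x
  rw [mem_ker, mem_fibre]
  have h1 : ∀ i : Fin k × Fin n, (hankel (coef π k) k).mulVec x i =
      prodAct π k (ext k x) (-((i.1 : ℕ) + 1 : ℕ)) i.2 := fun i => by
    rw [hankel_mulVec, prodAct_ext_neg]
  constructor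
  · intro h q hq
    rcases lt_or_ge q (-k) with h2 | h2
    · exact regular_prodAct π k (ext_regular x) q (by omega)
    · funext l
      have h3 := h1 (⟨(-q - 1).toNat, by omega⟩, l)
      rw [h] at h3
      rw [show q = -(((-q - 1).toNat + 1 : ℕ) : ℤ) by omega]
      exact h3.symm
  · intro h
    funext i
    rw [h1, h _ (by omega)]
    rfl

end Hankel

/-! ### The Ward equation as a recursion for the Laurent coefficients -/

section Ward

variable {n : ℕ}

theorem eq_zero_of_sum_pow_smul_eq_zero {N : ℕ} {M : ℕ → Mat n} {s : Set ℂ} (hs : s.Infinite)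
    (h : ∀ t ∈ s, ∑ j ∈ Finset.range N, t ^ j • M j = 0) {j : ℕ} (hj : j < N) : M j = 0 := by
  ext a b
  have h1 : (∑ j ∈ Finset.range N, Polynomial.C (M j a b) * Polynomial.X ^ j) = 0 := by
    refine Polynomial.eq_of_infinite_eval_eq _ _ (hs.mono fun t ht => ?_)
    have h2 := congrFun (congrFun (h t ht) a) b
    simp only [Matrix.sum_apply, Matrix.smul_apply, smul_eq_mul, Matrix.zero_apply] at h2
    simp only [Set.mem_ofPred_eq, Polynomial.eval_finsetSum, Polynomial.eval_mul, Polynomial.eval_C,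
      Polynomial.eval_pow, Polynomial.eval_X, Polynomial.eval_zero]
    rw [← h2]
    exact Finset.sum_congr rfl fun i _ => mul_comm _ _
  have h2 := congrArg (fun p => Polynomial.coeff p j) h1
  simpa [Polynomial.finsetSum_coeff, Polynomial.coeff_C_mul, Polynomial.coeff_X_pow, hj] using h2

theorem dirDeriv_comp {F : ℂ → Mat n} {q : ℝ × ℝ × ℝ}
    (hF : ∀ a b, DifferentiableAt ℝ (fun z => F z a b) ((q.1 : ℂ) + (q.2.1 : ℂ) * Complex.I))
    (e : ℝ × ℝ × ℝ) :
    dirDeriv (fun p : ℝ × ℝ × ℝ => F ((p.1 : ℂ) + (p.2.1 : ℂ) * Complex.I)) q e =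
      Matrix.of fun a b => fderiv ℝ (fun z => F z a b) ((q.1 : ℂ) + (q.2.1 : ℂ) * Complex.I)
        ((e.1 : ℂ) + (e.2.1 : ℂ) * Complex.I) := by
  ext a b
  let L : ℝ × ℝ × ℝ →L[ℝ] ℂ := Complex.ofRealCLM ∘L ContinuousLinearMap.fst ℝ ℝ (ℝ × ℝ) +
    (Complex.ofRealCLM ∘L ContinuousLinearMap.fst ℝ ℝ ℝ ∘L
      ContinuousLinearMap.snd ℝ ℝ (ℝ × ℝ)).smulRight Complex.I
  have h : HasFDerivAt (fun p : ℝ × ℝ × ℝ => F ((p.1 : ℂ) + (p.2.1 : ℂ) * Complex.I) a b) _ q :=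
    (hF a b).hasFDerivAt.comp q (f := fun p => L p) L.hasFDerivAt
  exact congrArg (fun T : ℝ × ℝ × ℝ →L[ℝ] ℂ => T e) h.fderiv

/-- The Ward equation in terms of Wirtinger derivatives. -/
theorem exists_wd_eq {φ : ℂ → ℂ → Mat n} (hφ : IsExtendedUniton φ)
    (hd : ∀ l ≠ Complex.I, ∀ a b, Differentiable ℝ fun z => φ z l a b) :
    ∃ U V : ℂ → Mat n, ∀ w l, l ≠ Complex.I → l ≠ -Complex.I →
      (l - Complex.I) • wdM (-Complex.I) (fun z => φ z l) w = U w * φ w l ∧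
      (l + Complex.I) • wdM Complex.I (fun z => φ z l) w = V w * φ w l := by
  obtain ⟨A, B, hAB⟩ := hφ.ward.lax
  let pt : ℂ → ℝ × ℝ × ℝ := fun w => (w.re, w.im, 0)
  -- In `A ± iB` the terms in `φ_x` and `φ_y` combine to `2(l - i)∂_w φ` and, for the minus sign, to
  -- `2(l + i)∂_{w̄} φ`.
  refine ⟨fun w => (2 : ℂ)⁻¹ • (A (pt w) + Complex.I • B (pt w)),
    fun w => (2 : ℂ)⁻¹ • (A (pt w) - Complex.I • B (pt w)), fun w l hl hl' => ?_⟩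
  obtain ⟨h1, h2⟩ := hAB (pt w) l (by simp [hl, hl'])
  have hpt : (((pt w).1 : ℂ) + ((pt w).2.1 : ℂ) * Complex.I) = w := Complex.re_add_im w
  rw [dirDeriv_comp (fun a b => hd l hl a b _), dirDeriv_comp (fun a b => hd l hl a b _)] at h1 h2
  simp only [hpt] at h1 h2
  constructor
  · rw [Matrix.smul_mul, Matrix.add_mul, Matrix.smul_mul, ← h1, ← h2]
    ext a b
    simp only [wdM, wd, Matrix.of_apply, Matrix.smul_apply, Matrix.add_apply, Matrix.sub_apply,
      smul_eq_mul, Complex.ofReal_one, Complex.ofReal_zero, zero_mul, one_mul, add_zero, zero_add,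
      Complex.ofReal_neg, neg_mul, map_neg]
    linear_combination (fderiv ℝ (fun z => φ z l a b) w Complex.I / 2) * Complex.I_mul_I
  · rw [Matrix.smul_mul, Matrix.sub_mul, Matrix.smul_mul, ← h1, ← h2]
    ext a b
    simp only [wdM, wd, Matrix.of_apply, Matrix.smul_apply, Matrix.sub_apply,
      smul_eq_mul, Complex.ofReal_one, Complex.ofReal_zero, zero_mul, one_mul, add_zero, zero_add,
      Complex.ofReal_neg, neg_mul, map_neg]
    linear_combination (fderiv ℝ (fun z => φ z l a b) w Complex.I / 2) * Complex.I_mul_I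

theorem wdM_sum_pow_smul (s t : ℂ) {N : ℕ} {C : ℕ → ℂ → Mat n} {w : ℂ}
    (hC : ∀ j a b, DifferentiableAt ℝ (fun z => C j z a b) w) :
    wdM s (fun z => ∑ j ∈ Finset.range N, t ^ j • C j z) w =
      ∑ j ∈ Finset.range N, t ^ j • wdM s (C j) w := by
  ext a b
  simp only [wdM, Matrix.of_apply, Matrix.sum_apply, Matrix.smul_apply, smul_eq_mul]
  rw [wd_sum s fun j _ => (hC j a b).const_mul (t ^ j)]
  refine Finset.sum_congr rfl fun j _ => ?_
  rw [wd_mul s (differentiableAt_const _) (hC j a b), wd_const, zero_mul, zero_add]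

/-- The recursion for the coefficients of an extended solution. -/
theorem exists_wd_coef_eq {φ : ℂ → ℂ → Mat n} (hφ : IsExtendedUniton φ) {k : ℕ}
    {C : ℕ → ℂ → Mat n} (hC : ∀ j a b, Differentiable ℝ fun z => C j z a b)
    (hC0 : ∀ z, C 0 z = 1) (hCk : ∀ j, k < j → ∀ z, C j z = 0)
    (hφC : ∀ z l, l ≠ Complex.I →
      φ z l = ∑ j ∈ Finset.range (k + 1), (l - Complex.I)⁻¹ ^ j • C j z) :
    ∃ U V : ℂ → Mat n, ∀ w,
      (∀ j, wdM (-Complex.I) (C (j + 1)) w = U w * C j w) ∧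
      (∀ j, wdM Complex.I (C (j + 1)) w + (2 * Complex.I) • wdM Complex.I (C j) w
        = V w * C j w) ∧
      (-Complex.I) • wdM (-Complex.I) (fun z => φ z 0) w = U w * φ w 0 ∧
      Complex.I • wdM Complex.I (fun z => φ z 0) w = V w * φ w 0 := by
  have hd : ∀ l ≠ Complex.I, ∀ a b, Differentiable ℝ fun z => φ z l a b := by
    intro l hl a b
    simp only [hφC _ l hl, Matrix.sum_apply, Matrix.smul_apply, smul_eq_mul]
    exact Differentiable.fun_sum fun j _ => (hC j a b).const_mul _
  obtain ⟨U, V, hUV⟩ := exists_wd_eq hφ hd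
  have hzero : ∀ s w, wdM s (C 0) w = 0 := fun s w => by
    rw [show C 0 = fun _ => 1 from funext hC0, wdM_const]
  have hzero' : ∀ s w j, k < j → wdM s (C j) w = 0 := fun s w j hj => by
    rw [show C j = fun _ => 0 from funext (hCk j hj), wdM_const]
  -- In the variable `t = 1 / (l - i)` the equations are polynomial; the excluded values are `l = ∞`
  -- and `l = -i`.
  have hinf : ({0, (-2 * Complex.I)⁻¹}ᶜ : Set ℂ).Infinite := (Set.toFinite _).infinite_compl
  have hl : ∀ t ∈ ({0, (-2 * Complex.I)⁻¹}ᶜ : Set ℂ), t ≠ 0 ∧ Complex.I + t⁻¹ ≠ Complex.I ∧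
      Complex.I + t⁻¹ ≠ -Complex.I ∧ Complex.I + t⁻¹ - Complex.I = t⁻¹ := by
    intro t ht
    simp only [Set.mem_compl_iff, Set.mem_insert_iff, Set.mem_singleton_iff, not_or] at ht
    refine ⟨ht.1, by simpa using ht.1, fun h => ht.2 ?_, by ring⟩
    rw [← inv_inv t]
    congr 1
    linear_combination h
  refine ⟨U, V, fun w => ⟨fun j => ?_, fun j => ?_, ?_, ?_⟩⟩
  · rcases lt_or_ge k j with hj | hj
    · rw [hzero' _ _ _ (by omega), hCk _ hj, Matrix.mul_zero]
    have h := eq_zero_of_sum_pow_smul_eq_zero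
      (M := fun j => wdM (-Complex.I) (C (j + 1)) w - U w * C j w) hinf (N := k + 1) (j := j)
      (fun t ht => ?_) (by omega)
    · exact sub_eq_zero.1 h
    · obtain ⟨h0, h1, h2, h3⟩ := hl t ht
      have h4 := (hUV w _ h1 h2).1
      simp only [hφC _ _ h1, h3, inv_inv] at h4
      rw [wdM_sum_pow_smul _ _ fun j a b => hC j a b w, Finset.sum_range_succ', hzero, smul_zero,
        add_zero] at h4
      simp only [smul_sub, Finset.sum_sub_distrib]
      rw [sub_eq_zero, Finset.sum_range_succ, hzero' _ _ _ (Nat.lt_succ_self k), smul_zero,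
        add_zero]
      simp only [← Matrix.mul_smul, ← Finset.mul_sum]
      rw [← h4, Finset.smul_sum]
      refine Finset.sum_congr rfl fun i _ => ?_
      rw [smul_smul, pow_succ', inv_mul_cancel_left₀ h0]
  · rcases lt_or_ge k j with hj | hj
    · rw [hzero' _ _ _ (by omega), hzero' _ _ _ hj, hCk _ hj, Matrix.mul_zero, smul_zero, add_zero]
    have h := eq_zero_of_sum_pow_smul_eq_zero
      (M := fun j => wdM Complex.I (C (j + 1)) w + (2 * Complex.I) • wdM Complex.I (C j) w
        - V w * C j w) hinf (N := k + 1) (j := j) (fun t ht => ?_) (by omega)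
    · exact sub_eq_zero.1 h
    · obtain ⟨h0, h1, h2, h3⟩ := hl t ht
      have h4 := (hUV w _ h1 h2).2
      simp only [hφC _ _ h1, h3, inv_inv] at h4
      rw [wdM_sum_pow_smul _ _ fun j a b => hC j a b w] at h4
      simp only [smul_sub, smul_add, Finset.sum_sub_distrib, Finset.sum_add_distrib]
      simp only [← Matrix.mul_smul, ← Finset.mul_sum]
      rw [sub_eq_zero, ← h4, show Complex.I + t⁻¹ + Complex.I = t⁻¹ + 2 * Complex.I by ring,
        add_smul]
      congr 1
      · rw [Finset.sum_range_succ, hzero' _ _ _ (Nat.lt_succ_self k), smul_zero, add_zero,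
          Finset.sum_range_succ' (fun j => t ^ j • wdM Complex.I (C j) w), hzero, smul_zero,
          add_zero, Finset.smul_sum]
        refine Finset.sum_congr rfl fun i _ => ?_
        rw [smul_smul, pow_succ', inv_mul_cancel_left₀ h0]
      · rw [Finset.smul_sum]
        exact Finset.sum_congr rfl fun i _ => smul_comm _ _ _
  · simpa using (hUV w 0 (by simp [eq_comm]) (by simp [eq_comm])).1
  · simpa using (hUV w 0 (by simp [eq_comm]) (by simp [eq_comm])).2

/-- Applied to a kernel vector, the recursion expresses `2i` times the `∂̄` of row `q` through the
vanishing row `q` and the `∂̄` of row `q + 1`. Rows with `q ≥ k` vanish identically, so descending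
induction applies. -/
theorem wdM_hankel_mulVec_eq_zero {k : ℕ} {C : ℕ → ℂ → Mat n} {V : Mat n} {w : ℂ}
    (hV : ∀ j, wdM Complex.I (C (j + 1)) w + (2 * Complex.I) • wdM Complex.I (C j) w = V * C j w)
    (hCk : ∀ j, k < j → ∀ z, C j z = 0) {x : Fin k × Fin n → ℂ}
    (hx : (hankel (fun j => C j w) k).mulVec x = 0) :
    (wdM Complex.I (fun z => hankel (fun j => C j z) k) w).mulVec x = 0 := by
  have h1 : wdM Complex.I (fun z => hankel (fun j => C j z) k) w =
      hankel (fun j => wdM Complex.I (C j) w) k := rfl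
  have hx' : ∀ q : ℕ, ∑ l ∈ Finset.range k, (C (q + l + 1) w).mulVec (ext k x l) = 0 := by
    intro q
    rcases lt_or_ge q k with hq | hq
    · funext b
      have := congrFun hx (⟨q, hq⟩, b)
      rwa [hankel_mulVec] at this
    · exact Finset.sum_eq_zero fun l _ => by rw [hCk _ (by omega), Matrix.zero_mulVec]
  have key : ∀ d q : ℕ, k ≤ q + d →
      ∑ l ∈ Finset.range k, (wdM Complex.I (C (q + l + 1)) w).mulVec (ext k x l) = 0 := by
    intro d
    induction d with
    | zero =>
      intro q hq
      refine Finset.sum_eq_zero fun l _ => ?_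
      rw [show C (q + l + 1) = fun _ => 0 from funext (hCk _ (by omega)), wdM_const,
        Matrix.zero_mulVec]
    | succ d ih =>
      intro q hq
      have h2 := ih (q + 1) (by omega)
      have h3 : ∀ l, (2 * Complex.I) • (wdM Complex.I (C (q + l + 1)) w).mulVec (ext k x l) =
          V.mulVec ((C (q + l + 1) w).mulVec (ext k x l)) -
            (wdM Complex.I (C (q + 1 + l + 1)) w).mulVec (ext k x l) := by
        intro l
        rw [Matrix.mulVec_mulVec, ← hV, Matrix.add_mulVec, Matrix.smul_mulVec,
          show q + 1 + l + 1 = q + l + 1 + 1 by omega]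
        abel
      have h4 : (2 * Complex.I) • ∑ l ∈ Finset.range k,
          (wdM Complex.I (C (q + l + 1)) w).mulVec (ext k x l) = 0 := by
        rw [Finset.smul_sum]
        simp only [h3, Finset.sum_sub_distrib]
        rw [← Matrix.mulVec_sum, hx', h2, Matrix.mulVec_zero, sub_zero]
      exact (smul_eq_zero_iff_right (by simp)).1 h4
  funext i
  rw [h1, hankel_mulVec, key k _ (by omega)]
  rfl

end Ward

/-! ### Behaviour at infinity -/

section Infinity

theorem norm_fderiv_comp_inv_le {f : ℂ → ℂ} {w : ℂ} (hw : w ≠ 0)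
    (hf : DifferentiableAt ℝ f w⁻¹) :
    ‖fderiv ℝ (fun z => f z⁻¹) w‖ ≤ ‖fderiv ℝ f w⁻¹‖ * (‖w‖ ^ 2)⁻¹ := by
  have h1 : HasFDerivAt (fun z : ℂ => z⁻¹) _ w :=
    (hasDerivAt_inv hw).hasFDerivAt.restrictScalars ℝ
  have h2 : HasFDerivAt (fun z => f z⁻¹) _ w := hf.hasFDerivAt.comp w h1
  rw [h2.fderiv]
  refine (ContinuousLinearMap.opNorm_comp_le _ _).trans ?_
  gcongr
  rw [ContinuousLinearMap.norm_restrictScalars, ContinuousLinearMap.norm_toSpanSingleton, norm_neg,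
    norm_inv, norm_pow]

/-- A function whose gradient is `O(|w|⁻²)` has a limit at infinity. -/
theorem exists_tendsto_of_fderiv_isBigO {f : ℂ → ℂ} (hf : Differentiable ℝ f)
    (hO : (fun w => fderiv ℝ f w) =O[cocompact ℂ] fun w => (‖w‖ ^ 2)⁻¹) :
    ∃ L, Tendsto f (cocompact ℂ) (𝓝 L) := by
  rw [← Metric.cobounded_eq_cocompact] at hO ⊢
  obtain ⟨M, hM0, hM⟩ := hO.exists_pos
  have hev : ∀ᶠ ζ in 𝓝[≠] (0 : ℂ), ‖fderiv ℝ (fun z => f z⁻¹) ζ‖ ≤ M := by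
    filter_upwards [(tendsto_inv₀_nhdsNE_zero (α := ℂ)).eventually hM.bound, self_mem_nhdsWithin]
      with ζ hζ hζ0
    refine (norm_fderiv_comp_inv_le hζ0 (hf _)).trans ?_
    have h0 : 0 < ‖ζ‖ ^ 2 := by have := norm_pos_iff.2 hζ0; positivity
    have hζ : ‖fderiv ℝ f ζ⁻¹‖ ≤ M * ‖(‖ζ⁻¹‖ ^ 2)⁻¹‖ := hζ
    rw [norm_inv, norm_pow, norm_norm, norm_inv, inv_pow, inv_inv] at hζ
    rwa [← div_eq_mul_inv, div_le_iff₀ h0]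
  obtain ⟨δ, hδ, hball⟩ := Metric.mem_nhdsWithin_iff.1 hev
  set g : ℂ → ℂ := fun z => f z⁻¹ with hg
  have hgd : ∀ ζ ≠ 0, DifferentiableAt ℝ g ζ := fun ζ hζ =>
    (hf _).comp ζ ((hasDerivAt_inv hζ).hasFDerivAt.restrictScalars ℝ).differentiableAt
  -- In the coordinate `1 / w` the gradient is bounded on a punctured disc, so the mean value
  -- inequality holds along segments that avoid the puncture.
  have hseg : ∀ x y : ℂ, ‖x‖ < δ → ‖y‖ < δ → (0 : ℂ) ∉ segment ℝ x y →
      ‖g y - g x‖ ≤ M * ‖y - x‖ := by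
    intro x y hx hy h0
    refine (convex_segment x y).norm_image_sub_le_of_norm_fderiv_le (𝕜 := ℝ)
      (fun z hz => hgd z fun h => h0 (h ▸ hz)) (fun z hz => hball ⟨?_, fun h => h0 (h ▸ hz)⟩)
      (left_mem_segment ℝ x y) (right_mem_segment ℝ x y)
    exact (convex_ball (0 : ℂ) δ).segment_subset (by simpa using hx) (by simpa using hy) hz
  have hpair : ∀ (x y : ℂ) {η : ℝ}, x ≠ 0 → y ≠ 0 → 0 < η → η ≤ δ → ‖x‖ < η → ‖y‖ < η →
      ‖g y - g x‖ ≤ 4 * M * η := by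
    intro x y η hx0 hy0 hη hηδ hx hy
    have hstep : ∀ u v : ℂ, ‖u‖ < η → ‖v‖ < η → (0 : ℂ) ∉ segment ℝ u v →
        ‖g v - g u‖ ≤ 2 * M * η := by
      intro u v hu hv h
      refine (hseg u v (hu.trans_le hηδ) (hv.trans_le hηδ) h).trans ?_
      have : ‖v - u‖ ≤ 2 * η := (norm_sub_le _ _).trans (by linarith)
      nlinarith
    by_cases h : (0 : ℂ) ∈ segment ℝ x y
    · obtain ⟨a, b, ha, hb, hab, h⟩ := h
      have hb0 : b ≠ 0 := by
        rintro rfl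
        rw [add_zero] at hab
        simp [hab, hx0] at h
      have ha0 : a ≠ 0 := by
        rintro rfl
        rw [zero_add] at hab
        simp [hab, hy0] at h
      have hne : ∀ c d : ℝ, c ≠ 0 ∨ d ≠ 0 → (c : ℂ) + d * Complex.I ≠ 0 := by
        intro c d hcd h0
        have h1 := congrArg Complex.re h0
        have h2 := congrArg Complex.im h0
        simp at h1 h2
        tauto
      -- A segment through the puncture is replaced by a detour over `i x`; this costs a factor of
      -- two.
      have h1 : (0 : ℂ) ∉ segment ℝ x (Complex.I * x) := by
        rintro ⟨c, d, -, -, hcd, h1⟩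
        rw [Complex.real_smul, Complex.real_smul] at h1
        refine mul_ne_zero (hne c d ?_) hx0 (by linear_combination h1)
        by_contra! h0
        rw [h0.1, h0.2, add_zero] at hcd
        exact zero_ne_one hcd
      have h2 : (0 : ℂ) ∉ segment ℝ (Complex.I * x) y := by
        rintro ⟨c, d, -, -, hcd, h1⟩
        rw [Complex.real_smul, Complex.real_smul] at h1 h
        refine mul_ne_zero (hne (-(d * a)) (b * c) ?_) hx0 ?_
        · by_contra! h0
          have hc : c = 0 := by simpa [hb0] using h0.2
          have hd : d = 0 := by simpa [ha0] using h0.1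
          rw [hc, hd, add_zero] at hcd
          exact zero_ne_one hcd
        · push_cast
          linear_combination (b : ℂ) * h1 - (d : ℂ) * h
      have hIx : ‖Complex.I * x‖ < η := by simpa using hx
      calc ‖g y - g x‖ = ‖(g y - g (Complex.I * x)) + (g (Complex.I * x) - g x)‖ := by
            rw [sub_add_sub_cancel]
        _ ≤ 2 * M * η + 2 * M * η :=
            (norm_add_le _ _).trans (add_le_add (hstep _ _ hIx hy h2) (hstep _ _ hx hIx h1))
        _ = _ := by ring
    · exact (hstep x y hx hy h).trans (by nlinarith)
  have hCauchy : Cauchy (map g (𝓝[≠] 0)) := by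
    rw [Metric.cauchy_iff]
    refine ⟨inferInstance, fun ε hε => ?_⟩
    set η := min δ (ε / (4 * M + 1)) with hη
    have hη0 : 0 < η := lt_min hδ (by positivity)
    refine ⟨g '' (Metric.ball 0 η ∩ {0}ᶜ), image_mem_map (Metric.mem_nhdsWithin_iff.2 ⟨η, hη0, subset_rfl⟩), ?_⟩
    rintro _ ⟨x, ⟨hx, hx0⟩, rfl⟩ _ ⟨y, ⟨hy, hy0⟩, rfl⟩
    rw [mem_ball_zero_iff] at hx hy
    rw [dist_comm, dist_eq_norm]
    refine (hpair x y hx0 hy0 hη0 (min_le_left _ _) hx hy).trans_lt ?_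
    have h1 : η ≤ ε / (4 * M + 1) := min_le_right _ _
    rw [le_div_iff₀ (by positivity)] at h1
    nlinarith
  obtain ⟨L, hL⟩ := CompleteSpace.complete hCauchy
  refine ⟨L, ?_⟩
  have h1 : Tendsto g (𝓝[≠] 0) (𝓝 L) := hL
  have h2 := h1.comp (tendsto_inv₀_cobounded' (α := ℂ))
  exact h2.congr fun w => by simp [g]

/-- The differential at `w` is `z ↦ ∂f z + ∂̄f z̄`. -/
theorem isBigO_fderiv_of_wd {f : ℂ → ℂ} {l : Filter ℂ} {g : ℂ → ℝ}
    (h1 : wd (-Complex.I) f =O[l] g) (h2 : wd Complex.I f =O[l] g) :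
    (fun w => fderiv ℝ f w) =O[l] g := by
  refine IsBigO.trans (IsBigO.of_bound 2 (Eventually.of_forall fun w => ?_))
    (h1.norm_left.add h2.norm_left)
  rw [Real.norm_of_nonneg (by positivity)]
  refine ContinuousLinearMap.opNorm_le_bound _ (by positivity) fun z => ?_
  have hz : fderiv ℝ f w z = (z.re : ℂ) * fderiv ℝ f w 1 + (z.im : ℂ) * fderiv ℝ f w Complex.I := by
    rw [← Complex.real_smul, ← Complex.real_smul, ← map_smul, ← map_smul, ← map_add]
    congr 1
    simp [Complex.re_add_im]
  have h : fderiv ℝ f w z = wd (-Complex.I) f w * z + wd Complex.I f w * starRingEnd ℂ z := by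
    rw [hz]
    have hz1 := Complex.re_add_im z
    have hz2 : starRingEnd ℂ z = z.re - z.im * Complex.I := by
      apply Complex.ext <;> simp
    rw [hz2]
    nth_rewrite 3 [← hz1]
    simp only [wd]
    linear_combination ((z.im : ℂ) * fderiv ℝ f w Complex.I) * Complex.I_mul_I
  rw [h]
  refine (norm_add_le _ _).trans ?_
  rw [norm_mul, norm_mul, RCLike.norm_conj]
  nlinarith [norm_nonneg (wd (-Complex.I) f w), norm_nonneg (wd Complex.I f w), norm_nonneg z]

theorem norm_wd_le {s : ℂ} (hs : ‖s‖ = 1) (f : ℂ → ℂ) (w : ℂ) : ‖wd s f w‖ ≤ ‖fderiv ℝ f w‖ := by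
  have h1 := (fderiv ℝ f w).le_opNorm 1
  have h2 := (fderiv ℝ f w).le_opNorm Complex.I
  rw [norm_one, mul_one] at h1
  rw [Complex.norm_I, mul_one] at h2
  rw [wd, norm_div, Complex.norm_two, div_le_iff₀ two_pos]
  refine (norm_add_le _ _).trans ?_
  rw [norm_mul, hs, one_mul]
  linarith

theorem norm_fderiv_conj (f : ℂ → ℂ) (w : ℂ) :
    ‖fderiv ℝ (fun z => starRingEnd ℂ (f z)) w‖ = ‖fderiv ℝ f w‖ := by
  have h : fderiv ℝ (fun z => starRingEnd ℂ (f z)) w =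
      (Complex.conjLIE.toContinuousLinearEquiv : ℂ →L[ℝ] ℂ).comp (fderiv ℝ f w) :=
    Complex.conjLIE.toContinuousLinearEquiv.comp_fderiv
  rw [h]
  exact Complex.conjLIE.toLinearIsometry.norm_toContinuousLinearMap_comp

theorem isBigO_fderiv_of_conj_inv {f g : ℂ → ℂ} (hg : ContDiff ℝ ∞ g)
    (hfg : ∀ w ≠ 0, f w = starRingEnd ℂ (g w⁻¹)) :
    (fun w => fderiv ℝ f w) =O[cocompact ℂ] fun w => (‖w‖ ^ 2)⁻¹ := by
  have hgd : Differentiable ℝ g := hg.differentiable (by simp)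
  have hb : (fun w => fderiv ℝ g w⁻¹) =O[cocompact ℂ] fun _ => (1 : ℝ) := by
    have h3 : Continuous (fderiv ℝ g) := hg.continuous_fderiv (by simp)
    have h4 := (h3.tendsto 0).comp (tendsto_inv₀_cobounded (α := ℂ))
    rw [Metric.cobounded_eq_cocompact] at h4
    exact h4.isBigO_one ℝ
  have h5 := hb.norm_left.mul (isBigO_refl (fun w : ℂ => (‖w‖ ^ 2)⁻¹) (cocompact ℂ))
  simp only [one_mul] at h5
  refine IsBigO.trans (IsBigO.of_bound 1 ?_) h5
  have hev : ∀ᶠ w in cocompact ℂ, w ≠ 0 :=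
    (isCompact_singleton (x := (0 : ℂ))).compl_mem_cocompact
  filter_upwards [hev] with w hw
  have h6 : f =ᶠ[𝓝 w] fun z => starRingEnd ℂ (g z⁻¹) :=
    Filter.mem_of_superset (isOpen_ne.mem_nhds hw) fun z hz => hfg z hz
  rw [h6.fderiv_eq, one_mul, norm_mul, norm_norm, Real.norm_of_nonneg (by positivity),
    norm_fderiv_conj fun z => g z⁻¹]
  exact norm_fderiv_comp_inv_le hw (hgd _)

/-- Entrywise `O(g)` at infinity. -/
def EntriesO {α β : Type*} (F : ℂ → Matrix α β ℂ) (g : ℂ → ℝ) : Prop :=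
  ∀ a b, (fun w => F w a b) =O[cocompact ℂ] g

theorem EntriesO.mul {α β γ : Type*} [Fintype β] {F : ℂ → Matrix α β ℂ} {G : ℂ → Matrix β γ ℂ}
    {f g : ℂ → ℝ} (hF : EntriesO F f) (hG : EntriesO G g) :
    EntriesO (fun w => F w * G w) (fun w => f w * g w) := fun a b => by
  simp only [Matrix.mul_apply]
  exact IsBigO.fun_sum fun i _ => (hF a i).mul (hG i b)

theorem EntriesO.add {α β : Type*} {F G : ℂ → Matrix α β ℂ} {g : ℂ → ℝ} (hF : EntriesO F g)
    (hG : EntriesO G g) : EntriesO (fun w => F w + G w) g := fun a b => (hF a b).add (hG a b)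

theorem EntriesO.sub {α β : Type*} {F G : ℂ → Matrix α β ℂ} {g : ℂ → ℝ} (hF : EntriesO F g)
    (hG : EntriesO G g) : EntriesO (fun w => F w - G w) g := fun a b => (hF a b).sub (hG a b)

theorem EntriesO.smul {α β : Type*} {F : ℂ → Matrix α β ℂ} {g : ℂ → ℝ} (hF : EntriesO F g)
    (c : ℂ) : EntriesO (fun w => c • F w) g := fun a b => (hF a b).const_mul_left c

theorem EntriesO.zero {α β : Type*} (g : ℂ → ℝ) : EntriesO (fun _ => (0 : Matrix α β ℂ)) g :=
  fun _ _ => isBigO_zero _ _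

theorem EntriesO.of_norm_le {α β : Type*} {F : ℂ → Matrix α β ℂ} (c : ℝ)
    (h : ∀ w a b, ‖F w a b‖ ≤ c) : EntriesO F fun _ => 1 := fun a b =>
  IsBigO.of_bound c (Eventually.of_forall fun w => by simpa using h w a b)

/-- Since `φ₀` is unitary and smooth in `1 / w`, the potentials `U = -i (∂φ₀) φ₀*` and `V = i (∂̄φ₀)
φ₀*` are `O(|w|⁻²)`. The recursions, with bounded `C_j`, pass this rate on to `∂C_j` directly and to
`∂̄C_j` by descending induction from `C_j = 0` for `j > k`. -/
theorem exists_tendsto_coef {n k : ℕ} {φ₀ K U V : ℂ → Mat n} {C : ℕ → ℂ → Mat n}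
    (hC : ∀ j a b, Differentiable ℝ fun z => C j z a b)
    (hCk : ∀ j, k < j → ∀ z, C j z = 0) (hC0 : ∀ z, C 0 z = 1)
    (hCb : ∀ j, EntriesO (C j) fun _ => 1)
    (hφ : ∀ w, star (φ₀ w) * φ₀ w = 1)
    (hK : ∀ a b, ContDiff ℝ ∞ fun ζ => K ζ a b) (hφK : ∀ ζ, ζ ≠ 0 → K ζ = (φ₀ ζ⁻¹)⁻¹)
    (h1 : ∀ w j, wdM (-Complex.I) (C (j + 1)) w = U w * C j w)
    (h2 : ∀ w j, wdM Complex.I (C (j + 1)) w + (2 * Complex.I) • wdM Complex.I (C j) w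
      = V w * C j w)
    (hU : ∀ w, (-Complex.I) • wdM (-Complex.I) φ₀ w = U w * φ₀ w)
    (hV : ∀ w, Complex.I • wdM Complex.I φ₀ w = V w * φ₀ w) (j : ℕ) :
    ∃ L, Tendsto (C j) (cocompact ℂ) (𝓝 L) := by
  have hφ' : ∀ w, φ₀ w * star (φ₀ w) = 1 := fun w => mul_eq_one_comm.1 (hφ w)
  have hφentry : ∀ w ≠ 0, ∀ a b, φ₀ w a b = starRingEnd ℂ (K w⁻¹ b a) := by
    intro w hw a b
    rw [hφK _ (inv_ne_zero hw), inv_inv, Matrix.inv_eq_left_inv (hφ w)]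
    simp [Matrix.star_apply]
  have hφfd : ∀ a b, (fun w => fderiv ℝ (fun z => φ₀ z a b) w) =O[cocompact ℂ]
      fun w => (‖w‖ ^ 2)⁻¹ := by
    intro a b
    exact isBigO_fderiv_of_conj_inv (g := fun ζ => K ζ b a) (hK b a) fun w hw => hφentry w hw a b
  have hφwd : ∀ s : ℂ, ‖s‖ = 1 → EntriesO (wdM s φ₀) fun w => (‖w‖ ^ 2)⁻¹ := fun s hs a b =>
    (IsBigO.of_bound 1 (Eventually.of_forall fun w => by
      rw [one_mul]; exact norm_wd_le hs _ w)).trans (hφfd a b)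
  have hφstar : EntriesO (fun w => star (φ₀ w)) fun _ => 1 := by
    refine EntriesO.of_norm_le 1 fun w a b => ?_
    have : star (φ₀ w) ∈ Matrix.unitaryGroup (Fin n) ℂ := by
      rw [Matrix.mem_unitaryGroup_iff, star_star]
      exact hφ w
    exact entry_norm_bound_of_unitary this a b
  have hUO : EntriesO U fun w => (‖w‖ ^ 2)⁻¹ := by
    have h := ((hφwd (-Complex.I) (by simp)).smul (-Complex.I)).mul hφstar
    simp only [hU, mul_one, Matrix.mul_assoc, hφ'] at h
    simpa only [Matrix.mul_one] using h
  have hVO : EntriesO V fun w => (‖w‖ ^ 2)⁻¹ := by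
    have h := ((hφwd Complex.I (by simp)).smul Complex.I).mul hφstar
    simp only [hV, mul_one, Matrix.mul_assoc, hφ'] at h
    simpa only [Matrix.mul_one] using h
  have hd : ∀ j, EntriesO (wdM (-Complex.I) (C j)) fun w => (‖w‖ ^ 2)⁻¹ := by
    rintro (_ | j)
    · have : wdM (-Complex.I) (C 0) = fun _ => 0 := by
        funext w
        rw [show C 0 = fun _ => 1 from funext hC0, wdM_const]
      rw [this]
      exact EntriesO.zero _
    · have h := hUO.mul (hCb j)
      simp only [← h1, mul_one] at h
      exact h
  have hdbar : ∀ d j, k < j + d → EntriesO (wdM Complex.I (C j)) fun w => (‖w‖ ^ 2)⁻¹ := by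
    intro d
    induction d with
    | zero =>
      intro j hj
      have : wdM Complex.I (C j) = fun _ => 0 := by
        funext w
        rw [show C j = fun _ => 0 from funext (hCk j hj), wdM_const]
      rw [this]
      exact EntriesO.zero _
    | succ d ih =>
      intro j hj
      have h := ((hVO.mul (hCb j)).sub (G := wdM Complex.I (C (j + 1))) (by
        simpa only [mul_one] using ih (j + 1) (by omega))).smul (2 * Complex.I)⁻¹
      simp only [← h2, mul_one, add_sub_cancel_left, smul_smul] at h
      rw [inv_mul_cancel₀ (by simp)] at h
      simpa only [one_smul] using h
  have hL : ∀ a b, ∃ L, Tendsto (fun w => C j w a b) (cocompact ℂ) (𝓝 L) := fun a b =>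
    exists_tendsto_of_fderiv_isBigO (hC j a b)
      (isBigO_fderiv_of_wd (hd j a b) (hdbar (k + 1) j (by omega) a b))
  choose L hL using hL
  exact ⟨Matrix.of L, tendsto_pi_nhds.2 fun a => tendsto_pi_nhds.2 fun b => hL a b⟩

end Infinity

/-! ### Bounds and limits of projections -/

section Projections

variable {n : ℕ}

/-- The reflection `2T - 1` is unitary, so its entries are bounded by `1`. -/
theorem norm_entry_le_one {T : Mat n} (hT : IsStarProjection T) (a b : Fin n) : ‖T a b‖ ≤ 1 := by
  have hTT : T * T = T := hT.isIdempotentElem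
  have hTs : star T = T := hT.isSelfAdjoint
  have hU : (2 : ℂ) • T - 1 ∈ Matrix.unitaryGroup (Fin n) ℂ := by
    rw [Matrix.mem_unitaryGroup_iff]
    simp only [star_sub, star_smul, hTs, star_one, star_ofNat]
    rw [mul_sub, sub_mul, mul_one, one_mul, Matrix.smul_mul, Matrix.mul_smul, hTT]
    module
  have h1 := entry_norm_bound_of_unitary hU a b
  have h2 : ‖(1 : Mat n) a b‖ ≤ 1 := by
    rw [Matrix.one_apply]
    split_ifs <;> simp
  have h3 : (2 : ℂ) * T a b = ((2 : ℂ) • T - 1) a b + (1 : Mat n) a b := by simp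
  have h4 : ‖(2 : ℂ) * T a b‖ ≤ 2 := by
    rw [h3]
    exact (norm_add_le _ _).trans (by linarith)
  rw [norm_mul, Complex.norm_two] at h4
  linarith

/-- The trace is continuous, so this carries ranks over to limits of projections. -/
theorem finrank_im_eq_trace {T : Mat n} (hT : T * T = T) :
    (Module.finrank ℂ (im T) : ℂ) = T.trace := by
  have h : LinearMap.IsProj (im T) T.mulVecLin :=
    ⟨fun x => ⟨x, rfl⟩, fun x hx => (mem_im_iff hT).1 hx⟩
  rw [← h.trace]
  exact (Matrix.trace_toLin'_eq T)

theorem P_induction {k : ℕ} {π : ℕ → ℂ → Mat n} (p : (ℂ → Mat n) → Prop)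
    (hone : p fun _ => 1) (hzero : p fun _ => 0)
    (hstep : ∀ i ∈ Finset.Icc 1 k, ∀ F G, p F → p G → p fun w => F w + perp (π i w) * G w)
    {m : ℕ} (hm : m ≤ k) (j : ℕ) : p fun w => P (fun i => π i w) m j := by
  induction m generalizing j with
  | zero =>
    cases j with
    | zero => simpa only [P_zero_right] using hone
    | succ j => simpa only [P_eq_zero _ (Nat.succ_pos j)] using hzero
  | succ m ih =>
    cases j with
    | zero => simpa only [P_zero_right] using hone
    | succ j =>
      simp only [P_succ_succ]
      exact hstep (m + 1) (by simp; omega) _ _ (ih (by omega) (j + 1)) (ih (by omega) j)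

theorem differentiable_coef {k : ℕ} {π : ℕ → ℂ → Mat n}
    (hπ : ∀ j ∈ Finset.Icc 1 k, ∀ a b, Differentiable ℝ fun w => π j w a b) {m : ℕ} (hm : m ≤ k)
    (j : ℕ) (a b : Fin n) : Differentiable ℝ fun w => coef (fun i => π i w) m j a b := by
  have h := P_induction (π := π) (fun F => ∀ a b, Differentiable ℝ fun w => F w a b)
    (fun _ _ => differentiable_const _) (fun _ _ => differentiable_const _)
    (fun i hi F G hF hG a b => by
      simp only [Matrix.add_apply]
      refine (hF a b).fun_add fun w => differentiableAt_matrix_mul (fun a b => ?_)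
        (fun a b => hG a b w) a b
      simp only [perp, Matrix.sub_apply]
      exact (differentiableAt_const _).fun_sub (hπ i hi a b w)) hm j a b
  simp only [coef, Matrix.smul_apply, smul_eq_mul]
  exact h.const_mul _

theorem coef_entriesO {k : ℕ} {π : ℕ → ℂ → Mat n}
    (hπ : ∀ j ∈ Finset.Icc 1 k, ∀ w, IsStarProjection (π j w)) {m : ℕ} (hm : m ≤ k) (j : ℕ) :
    EntriesO (fun w => coef (fun i => π i w) m j) fun _ => 1 := by
  have hone : EntriesO (fun _ : ℂ => (1 : Mat n)) fun _ => 1 := fun a b => isBigO_const_const _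
    one_ne_zero _
  have h := P_induction (π := π) (fun F => EntriesO F fun _ => 1) hone (EntriesO.zero _)
    (fun i hi F G hF hG => by
      refine hF.add ?_
      have h1 : EntriesO (π i) fun _ => 1 :=
        EntriesO.of_norm_le 1 fun w => norm_entry_le_one (hπ i hi w)
      simpa only [mul_one, perp] using (hone.sub h1).mul hG) hm j
  exact h.smul _

theorem tendsto_coef {k : ℕ} {α : Type*} {l : Filter α} {π : ℕ → α → Mat n} {σ : ℕ → Mat n}
    (h : ∀ j ∈ Finset.Icc 1 k, Tendsto (π j) l (𝓝 (σ j))) {m : ℕ} (hm : m ≤ k) (j : ℕ) :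
    Tendsto (fun w => coef (fun i => π i w) m j) l (𝓝 (coef σ m j)) := by
  have h1 : ∀ m ≤ k, ∀ j, Tendsto (fun w => P (fun i => π i w) m j) l (𝓝 (P σ m j)) := by
    intro m
    induction m with
    | zero =>
      rintro - (_ | j)
      · simpa only [P_zero_right] using tendsto_const_nhds
      · simpa only [P_eq_zero _ (Nat.succ_pos j)] using tendsto_const_nhds
    | succ m ih =>
      rintro hm (_ | j)
      · simpa only [P_zero_right] using tendsto_const_nhds
      · simp only [P_succ_succ, perp]
        exact (ih (by omega) _).add ((tendsto_const_nhds.sub (h _ (by simp; omega))).mul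
          (ih (by omega) _))
  simp only [coef]
  exact Tendsto.const_smul (h1 m hm j) ((2 * Complex.I) ^ j : ℂ)

/-- The kernel of the Hankel matrix does not jump at infinity. -/
theorem finrank_ker_limit {k : ℕ} {π : ℕ → ℂ → Mat n}
    (hπ : ∀ j ∈ Finset.Icc 1 k, ∀ w, IsStarProjection (π j w)) {m : ℕ → ℕ}
    (hm : ∀ j ∈ Finset.Icc 1 k, ∀ w, Module.finrank ℂ (im (π j w)) = m j)
    {L : ℕ → Mat n}
    (hL : ∀ j, Tendsto (fun w => coef (fun i => π i w) k j) (cocompact ℂ) (𝓝 (L j))) :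
    Module.finrank ℂ (ker (hankel L k)) = k * n - ∑ j ∈ Finset.range k, (n - m (j + 1)) := by
  -- The `π_j` themselves are not known to converge at infinity. Along the integers a subsequence of
  -- all of them converges by compactness; the limits are idempotents of the same ranks, and their
  -- Hankel matrix must be the limit one. The slot `j = 0` is filled with `0` because nothing is
  -- known about `π 0`.
  let x : ℕ → Fin (k + 1) → Fin n → Fin n → ℂ := fun ν j a b =>
    if (j : ℕ) ∈ Finset.Icc 1 k then π j (ν : ℂ) a b else 0
  have hx : ∀ ν, x ν ∈ Metric.closedBall (0 : Fin (k + 1) → Fin n → Fin n → ℂ) 1 := by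
    intro ν
    rw [mem_closedBall_zero_iff]
    refine (pi_norm_le_iff_of_nonneg zero_le_one).2 fun j =>
      (pi_norm_le_iff_of_nonneg zero_le_one).2 fun a =>
      (pi_norm_le_iff_of_nonneg zero_le_one).2 fun b => ?_
    by_cases hj : (j : ℕ) ∈ Finset.Icc 1 k
    · simp only [x, if_pos hj]
      exact norm_entry_le_one (hπ j hj _) a b
    · simp only [x, if_neg hj, norm_zero, zero_le_one]
  obtain ⟨y, -, ν, hν, hy⟩ := (isCompact_closedBall _ _).tendsto_subseq hx
  let ρ : Fin (k + 1) → Mat n := fun j => Matrix.of (y j)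
  have hρ : ∀ j (hj : j ∈ Finset.Icc 1 k),
      Tendsto (fun i => π j ((ν i : ℕ) : ℂ)) atTop (𝓝 (ρ (Fin.ofNat (k + 1) j))) := by
    intro j hj
    have h1 := tendsto_pi_nhds.1 hy (Fin.ofNat (k + 1) j)
    have h2 : ((Fin.ofNat (k + 1) j : Fin (k + 1)) : ℕ) = j := by
      rw [Fin.val_ofNat, Nat.mod_eq_of_lt]
      have := (Finset.mem_Icc.1 hj).2
      omega
    refine h1.congr fun i => ?_
    funext a b
    simp only [Function.comp_apply, x, h2, if_pos hj]
  have hρi : ∀ j ∈ Finset.Icc 1 k,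
      ρ (Fin.ofNat (k + 1) j) * ρ (Fin.ofNat (k + 1) j) = ρ (Fin.ofNat (k + 1) j) := by
    intro j hj
    refine tendsto_nhds_unique ((hρ j hj).mul (hρ j hj)) ((hρ j hj).congr fun i => ?_)
    exact (hπ j hj _).isIdempotentElem.symm
  have hρm : ∀ j ∈ Finset.Icc 1 k, Module.finrank ℂ (im (ρ (Fin.ofNat (k + 1) j))) = m j := by
    intro j hj
    have h1 : Tendsto (fun i => (π j ((ν i : ℕ) : ℂ)).trace) atTop
        (𝓝 (ρ (Fin.ofNat (k + 1) j)).trace) :=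
      ((continuous_id.matrix_trace).tendsto _).comp (hρ j hj)
    have h2 : ∀ i, (π j ((ν i : ℕ) : ℂ)).trace = m j := fun i => by
      rw [← finrank_im_eq_trace (hπ j hj _).isIdempotentElem, hm j hj]
    simp only [h2] at h1
    have h3 := tendsto_nhds_unique h1 tendsto_const_nhds
    rw [← finrank_im_eq_trace (hρi j hj)] at h3
    exact_mod_cast h3
  have hcoef : ∀ j, coef (fun i => ρ (Fin.ofNat (k + 1) i)) k j = L j := by
    intro j
    have hν' : Tendsto (fun i => ((ν i : ℕ) : ℂ)) atTop (cocompact ℂ) := by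
      rw [← Metric.cobounded_eq_cocompact]
      exact (tendsto_natCast_atTop_cobounded (α := ℂ)).comp hν.tendsto_atTop
    exact tendsto_nhds_unique (tendsto_coef (π := fun j i => π j ((ν i : ℕ) : ℂ)) hρ le_rfl j)
      ((hL j).comp hν')
  have h1 : (fun j => coef (fun i => ρ (Fin.ofNat (k + 1) i)) k j) = L := funext hcoef
  rw [← h1]
  have h2 := ker_hankel (fun i => ρ (Fin.ofNat (k + 1) i)) k
  rw [show ker (hankel (fun j => coef (fun i => ρ (Fin.ofNat (k + 1) i)) k j) k) = _ from h2,
    finrank_fibre hρi le_rfl]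
  congr 1
  exact Finset.sum_congr rfl fun j hj => by
    rw [hρm (j + 1) (by simp at hj ⊢; omega)]

end Projections

/-! ### Polynomial sections and their derivatives -/

section Sections

/-- Two polynomials with vanishing Wronskian are proportional. -/
theorem exists_eq_C_mul_of_wronskian {p q : ℂ[X]} (hq : q ≠ 0)
    (h : q * derivative p = p * derivative q) : ∃ κ, p = C κ * q := by
  set g := EuclideanDomain.gcd p q
  obtain ⟨a, hpa⟩ : g ∣ p := EuclideanDomain.gcd_dvd_left p q
  obtain ⟨b, hqb⟩ : g ∣ q := EuclideanDomain.gcd_dvd_right p q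
  have hg : g ≠ 0 := by
    rintro h0
    rw [h0, zero_mul] at hqb
    exact hq hqb
  have hab : IsCoprime a b := by
    refine ⟨EuclideanDomain.gcdA p q, EuclideanDomain.gcdB p q, mul_left_cancel₀ hg ?_⟩
    have h1 : g = p * EuclideanDomain.gcdA p q + q * EuclideanDomain.gcdB p q :=
      EuclideanDomain.gcd_eq_gcd_ab p q
    linear_combination EuclideanDomain.gcdA p q * (-hpa) + EuclideanDomain.gcdB p q * (-hqb) - h1
  clear_value g
  have hw : wronskian a b = 0 := by
    rw [hpa, hqb] at h
    simp only [derivative_mul] at h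
    have : g ^ 2 * wronskian a b = 0 := by
      rw [wronskian]
      linear_combination -h
    exact (mul_eq_zero.1 this).resolve_left (pow_ne_zero 2 hg)
  -- After division by the gcd the polynomials are coprime, and then a vanishing Wronskian makes
  -- both constant.
  obtain ⟨ha, hb⟩ := hab.wronskian_eq_zero_iff.1 hw
  have ha' := eq_C_of_derivative_eq_zero ha
  have hb' := eq_C_of_derivative_eq_zero hb
  have hb0 : b.coeff 0 ≠ 0 := by
    intro h0
    rw [h0, C_0] at hb'
    rw [hb', mul_zero] at hqb
    exact hq hqb
  refine ⟨a.coeff 0 / b.coeff 0, ?_⟩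
  rw [hpa, hqb, ha', hb', coeff_C_zero, coeff_C_zero, mul_left_comm, ← C_mul, div_mul_cancel₀ _ hb0]

/-- The value at `w` of a vector of polynomials. -/
def ev {α : Type*} (w : ℂ) (x : α → ℂ[X]) : α → ℂ := fun a => (x a).eval w

/-- The derivative of a vector of polynomials. -/
noncomputable def dv {α : Type*} (x : α → ℂ[X]) : α → ℂ[X] := fun a => derivative (x a)

/-- With a left inverse `G` of the matrix of vectors at `w₀`, the determinant of `G Y(w)` is a
polynomial in `w` equal to `1` at `w₀`; independence can fail only at its roots. -/
theorem finite_not_linearIndependent {s n : ℕ} {y : Fin s → Fin n → ℂ[X]} {w₀ : ℂ}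
    (h : LinearIndependent ℂ fun t => ev w₀ (y t)) :
    {w | ¬ LinearIndependent ℂ fun t => ev w (y t)}.Finite := by
  have hcomb : ∀ (w : ℂ) (g : Fin s → ℂ), ∑ t, g t • ev w (y t) =
      (Matrix.of fun b t => (y t b).eval w : Matrix (Fin n) (Fin s) ℂ).mulVec g := by
    intro w g
    funext b
    simp only [Finset.sum_apply, Pi.smul_apply, smul_eq_mul, Matrix.mulVec, dotProduct,
      Matrix.of_apply, ev]
    exact Finset.sum_congr rfl fun t _ => mul_comm _ _
  let Y : ℂ → Matrix (Fin n) (Fin s) ℂ := fun w => Matrix.of fun b t => (y t b).eval w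
  obtain ⟨G, hG⟩ := (Y w₀).mulVecLin.exists_leftInverse_of_injective (by
    rw [LinearMap.ker_eq_bot']
    intro g hg
    funext t
    exact Fintype.linearIndependent_iff.1 h g ((hcomb w₀ g).trans hg) t)
  have hG' : LinearMap.toMatrix' G * Y w₀ = 1 := by
    have h1 := congrArg LinearMap.toMatrix' hG
    rwa [LinearMap.toMatrix'_comp, LinearMap.toMatrix'_id, ← Matrix.toLin'_apply',
      LinearMap.toMatrix'_toLin'] at h1
  let D : ℂ[X] := ((LinearMap.toMatrix' G).map C * Matrix.of fun b t => y t b).det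
  have hD : ∀ w, D.eval w = (LinearMap.toMatrix' G * Y w).det := by
    intro w
    simp only [D]
    rw [← coe_evalRingHom, RingHom.map_det]
    congr 1
    ext i t
    simp [Matrix.mul_apply, Y, eval_finsetSum]
  have hD0 : D ≠ 0 := by
    intro h0
    have := hD w₀
    rw [h0, hG'] at this
    simp at this
  refine (finite_setOfPred_isRoot hD0).subset fun w hw => ?_
  by_contra hr
  refine hw (Fintype.linearIndependent_iff.2 fun g hg t => ?_)
  have h2 : (LinearMap.toMatrix' G * Y w).mulVec g = 0 := by
    rw [← Matrix.mulVec_mulVec, ← hcomb, hg, Matrix.mulVec_zero]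
  exact congrFun (Matrix.eq_zero_of_mulVec_eq_zero (by rw [← hD]; exact hr) h2) t

theorem wd_mulVec (s : ℂ) {α β : Type*} [Fintype β] {F : ℂ → Matrix α β ℂ} {x : β → ℂ → ℂ} {w : ℂ}
    (hF : ∀ a b, DifferentiableAt ℝ (fun z => F z a b) w)
    (hx : ∀ b, DifferentiableAt ℝ (x b) w) (a : α) :
    wd s (fun z => (F z).mulVec (fun b => x b z) a) w =
      (wdM s F w).mulVec (fun b => x b w) a + (F w).mulVec (fun b => wd s (x b) w) a := by
  simp only [Matrix.mulVec, dotProduct, wdM, Matrix.of_apply]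
  refine (wd_sum s fun i _ => (hF a i).fun_mul (hx i)).trans ?_
  rw [← Finset.sum_add_distrib]
  exact Finset.sum_congr rfl fun i _ => wd_mul s (hF a i) (hx i)

variable {n k : ℕ}

/-- The rows `C_{q+1}, …, C_{q+k}` of the infinite Hankel matrix. -/
def hankelRow (C : ℕ → Mat n) (k q : ℕ) : Matrix (Fin n) (Fin k × Fin n) ℂ :=
  Matrix.of fun a j => C (q + j.1 + 1) a j.2

theorem hankelRow_mulVec (C : ℕ → Mat n) (q : ℕ) (x : Fin k × Fin n → ℂ) :
    (hankelRow C k q).mulVec x = ∑ l ∈ Finset.range k, (C (q + l + 1)).mulVec (ext k x l) := by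
  funext a
  rw [Finset.sum_range, Finset.sum_apply, Matrix.mulVec, dotProduct, Fintype.sum_prod_type]
  refine Finset.sum_congr rfl fun l _ => ?_
  rw [Matrix.mulVec, dotProduct]
  exact Finset.sum_congr rfl fun b _ => by rw [ext_natCast]; rfl

theorem hankelRow_mulVec_eq_zero {π : ℕ → Mat n} {x : Fin k × Fin n → ℂ} {d : ℤ} {q : ℕ}
    (hx : prodAct π k (ext k x) ∈ regular d) (hq : -(q + 1 : ℤ) < d) :
    (hankelRow (coef π k) k q).mulVec x = 0 := by
  rw [hankelRow_mulVec, ← prodAct_ext_neg]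
  exact hx _ (by push_cast; exact hq)

theorem regular_of_hankelRow {π : ℕ → Mat n} {x : Fin k × Fin n → ℂ} {d : ℕ}
    (hx : ∀ q ≥ d, (hankelRow (coef π k) k q).mulVec x = 0) :
    prodAct π k (ext k x) ∈ regular (-d) := by
  intro q hq
  have h := hx (-q - 1).toNat (by omega)
  rw [hankelRow_mulVec, ← prodAct_ext_neg] at h
  rwa [show -(((-q - 1).toNat + 1 : ℕ) : ℤ) = q by omega] at h

/-- Each differentiation of a section raises the order of the pole by at most one. -/
theorem regular_prodAct_derivative {π : ℕ → ℂ → Mat n} {U : ℂ → Mat n}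
    (hd : ∀ j a b, Differentiable ℝ fun w => coef (fun i => π i w) k j a b)
    (hU : ∀ w j, wdM (-Complex.I) (fun z => coef (fun i => π i z) k (j + 1)) w
      = U w * coef (fun i => π i w) k j)
    {x : Fin k × Fin n → ℂ[X]} (hx : ∀ w, ev w x ∈ fibre (fun i => π i w) k k) (j : ℕ) (w : ℂ) :
    prodAct (fun i => π i w) k (ext k (ev w (dv^[j] x))) ∈ regular (-j) := by
  refine regular_of_hankelRow ?_
  induction j generalizing w with
  | zero =>
    intro q _
    exact hankelRow_mulVec_eq_zero (d := 0) (hx w) (by omega)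
  | succ j ih =>
    intro q hq
    obtain ⟨q, rfl⟩ := Nat.exists_eq_add_of_le' (show 1 ≤ q by omega)
    set y := dv^[j] x with hy
    rw [Function.iterate_succ_apply', ← hy]
    -- Differentiating row `q + 1` gives `U` times row `q`. So if all rows from `j` on annihilate
    -- `y`, differentiating the identity for row `q + 1` leaves only row `q + 1` applied to `y'`,
    -- and only row `j` is lost.
    have hUw : wdM (-Complex.I) (fun z => hankelRow (coef (fun i => π i z) k) k (q + 1)) w =
        U w * hankelRow (coef (fun i => π i w) k) k q := by
      ext a i
      have h := congrFun (congrFun (hU w (q + i.1 + 1)) a) i.2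
      rw [show q + (i.1 : ℕ) + 1 + 1 = q + 1 + i.1 + 1 by omega] at h
      exact h
    funext a
    have h1 := wd_mulVec (-Complex.I) (w := w)
      (F := fun z => hankelRow (coef (fun i => π i z) k) k (q + 1))
      (x := fun b z => (y b).eval z) (fun a b => hd _ _ _ w)
      (fun b => (y b).differentiableAt.restrictScalars ℝ) a
    have h2 : (fun z => (hankelRow (coef (fun i => π i z) k) k (q + 1)).mulVec
        (fun b => (y b).eval z) a) = fun _ => 0 := by
      funext z
      exact congrFun (ih z (q + 1) (by omega)) a
    rw [h2, wd_const, hUw, ← Matrix.mulVec_mulVec] at h1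
    have h3 : (hankelRow (coef (fun i => π i w) k) k q).mulVec (fun b => (y b).eval w) = 0 :=
      ih w q (by omega)
    rw [h3, Matrix.mulVec_zero, Pi.zero_apply, zero_add] at h1
    simp only [wd_polynomial] at h1
    exact h1.symm

/-- The tuple of rational maps with the given polynomial coefficients. -/
noncomputable def ratTuple (x : Fin k × Fin n → ℂ[X]) (j : ℕ) (l : Fin n) : RatFunc ℂ :=
  algebraMap ℂ[X] (RatFunc ℂ) (if h : j < k then x (⟨j, h⟩, l) else 0)

theorem regularAt_ratTuple (x : Fin k × Fin n → ℂ[X]) (j : ℕ) (w : ℂ) :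
    RegularAt (ratTuple x j) w := fun l => by
  simp [ratTuple, RatFunc.denom_algebraMap]

theorem iteratedDeriv_ev {α : Type*} [Fintype α] (y : α → ℂ[X]) (ℓ : ℕ) :
    iteratedDeriv ℓ (fun w => ev w y) = fun w => ev w (dv^[ℓ] y) := by
  induction ℓ with
  | zero => rfl
  | succ ℓ ih =>
    rw [iteratedDeriv_succ, ih]
    funext w
    rw [Function.iterate_succ_apply']
    exact (hasDerivAt_pi.2 fun a => (dv^[ℓ] y a).hasDerivAt w).deriv

theorem dv_iterate_apply {α : Type*} (x : α → ℂ[X]) (ℓ : ℕ) (a : α) :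
    dv^[ℓ] x a = derivative^[ℓ] (x a) := by
  induction ℓ generalizing x with
  | zero => rfl
  | succ ℓ ih => rw [Function.iterate_succ_apply, Function.iterate_succ_apply, ih]; rfl

theorem iteratedDeriv_ratMap_ratTuple (x : Fin k × Fin n → ℂ[X]) (j ℓ : ℕ) (w : ℂ) :
    iteratedDeriv ℓ (ratMap (ratTuple x j)) w = ext k (ev w (dv^[ℓ] x)) (j : ℤ) := by
  have h1 : ratMap (ratTuple x j) =
      fun w => ev w fun l => if h : j < k then x (⟨j, h⟩, l) else 0 := by
    funext w l
    simp [ratMap, ratTuple, RatFunc.eval_algebraMap, ev, eval₂_id]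
  rw [h1, iteratedDeriv_ev]
  funext l
  simp only [ev]
  rw [dv_iterate_apply]
  by_cases hj : j < k
  · rw [ext_natCast _ ⟨j, hj⟩ l, dif_pos hj, ev, dv_iterate_apply]
  · have : ¬ ((0 : ℤ) ≤ j ∧ (j : ℤ) < k) := by omega
    simp [ext, hj]

theorem Dv_ratTuple (π : ℕ → ℂ → Mat n) (x : Fin k × Fin n → ℂ[X]) (ℓ p : ℕ) (w : ℂ) :
    Dv π (ratTuple x) ℓ (p + 1) w =
      prodAct (fun i => π i w) p (ext k (ev w (dv^[ℓ] x))) 0 := by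
  rw [Dv, prodAct_apply, Nat.add_sub_cancel]
  refine Finset.sum_congr rfl fun j _ => ?_
  rw [iteratedDeriv_ratMap_ratTuple, zero_add]

/-- Two tuples of projections with the same fibre agree. -/
theorem fibre_eq_of_fibre_eq {π ρ : ℕ → Mat n} (hπ : ∀ j ∈ Finset.Icc 1 k, π j * π j = π j)
    (htr : ∀ j ∈ Finset.Icc 2 k, im (π j) ⊓ im (perp (π (j - 1))) = ⊥)
    (hρ : ∀ j ∈ Finset.Icc 1 k, ρ j * ρ j = ρ j)
    (htr' : ∀ j ∈ Finset.Icc 2 k, im (ρ j) ⊓ im (perp (ρ (j - 1))) = ⊥)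
    (h : fibre π k k = fibre ρ k k) {p : ℕ} (hp : p ≤ k) : fibre π k p = fibre ρ k p := by
  -- `x` lies in the fibre of level `p` exactly when `(l - i)^{k-p} x`, truncated, lies in that of
  -- level `k`: each factor adds at most one order of pole, and conversely transversality removes
  -- one per dropped factor. The lower fibres are thus determined by the top one.
  have key : ∀ {π : ℕ → Mat n}, (∀ j ∈ Finset.Icc 1 k, π j * π j = π j) →
      (∀ j ∈ Finset.Icc 2 k, im (π j) ⊓ im (perp (π (j - 1))) = ⊥) → ∀ x : Fin k × Fin n → ℂ,
      x ∈ fibre π k p ↔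
        (fun i : Fin k × Fin n => shift (-((k - p : ℕ) : ℤ)) (ext k x) (i.1 : ℕ) i.2) ∈
          fibre π k k := by
    intro π hπ htr x
    have h0 : shift (-((k - p : ℕ) : ℤ)) (ext k x) ∈ regular 0 :=
      shift_mem_regular.2 (regular_anti (by omega) (ext_regular x))
    have h1 := regular_prodAct π k (sub_ext_regular (k := k) h0)
    rw [sub_self, map_sub] at h1
    have h2 : ∀ {a b : ℤ → Vec n}, a - b ∈ regular 0 → (b ∈ regular 0 ↔ a ∈ regular 0) :=
      fun {a b} hab => ⟨fun hb => by simpa using add_mem hab hb,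
        fun ha => by simpa using sub_mem ha hab⟩
    rw [mem_fibre, mem_fibre, h2 h1, prodAct_shift, shift_mem_regular, zero_add]
    constructor
    · intro h2
      have h3 : ∀ d : ℕ, prodAct π (p + d) (ext k x) ∈ regular (-d) := by
        intro d
        induction d with
        | zero => simpa using h2
        | succ d ih =>
          have h4 := regular_simpleAct (π (p + d + 1)) ih
          rwa [show -(d : ℤ) - 1 = -((d + 1 : ℕ) : ℤ) by push_cast; ring] at h4
      have := h3 (k - p)
      rwa [Nat.add_sub_cancel' hp] at this
    · intro h2
      refine regular_prodAct_of_pole hπ htr (k - p) (by omega) (ext_regular x) ?_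
      rwa [Nat.add_sub_cancel' hp]
  ext x
  rw [key hπ htr, key hρ htr', h]

theorem eq_of_im_eq {S T : Mat n} (hS : IsStarProjection S) (hT : IsStarProjection T)
    (h : im S = im T) : S = T := by
  have h1 : ∀ {S T : Mat n}, IsStarProjection S → IsStarProjection T → im S = im T → T * S = S := by
    intro S T hS hT h
    refine Matrix.ext_of_mulVec_single fun j => ?_
    rw [← Matrix.mulVec_mulVec]
    refine (mem_im_iff hT.isIdempotentElem).1 ?_
    rw [← h]
    exact ⟨_, rfl⟩
  have h2 := congrArg star (h1 hS hT h)
  rw [star_mul, hS.isSelfAdjoint.star_eq, hT.isSelfAdjoint.star_eq, h1 hT hS h.symm] at h2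
  exact h2.symm

theorem prodAct_congr {π ρ : ℕ → Mat n} {p : ℕ} (h : ∀ i ∈ Finset.Icc 1 p, π i = ρ i) :
    prodAct π p = prodAct ρ p := by
  induction p with
  | zero => rfl
  | succ p ih =>
    have h1 := ih fun i hi => h i (by simp at hi ⊢; omega)
    have h2 := h (p + 1) (by simp)
    simp only [prodAct]
    rw [h1, h2]

/-- `Im π_{p+1}` is the set of constant terms of `φ_p x` for `x` in the fibre of level `p + 1`, so
the projections are recovered one after another. -/
theorem eq_of_fibre_eq {π ρ : ℕ → Mat n} (hπ : ∀ j ∈ Finset.Icc 1 k, IsStarProjection (π j))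
    (htr : ∀ j ∈ Finset.Icc 2 k, im (π j) ⊓ im (perp (π (j - 1))) = ⊥)
    (hρ : ∀ j ∈ Finset.Icc 1 k, IsStarProjection (ρ j))
    (htr' : ∀ j ∈ Finset.Icc 2 k, im (ρ j) ⊓ im (perp (ρ (j - 1))) = ⊥)
    (h : fibre π k k = fibre ρ k k) {p : ℕ} (hp : p ≤ k) : ∀ i ∈ Finset.Icc 1 p, π i = ρ i := by
  have hπ' := fun j hj => (hπ j hj).isIdempotentElem
  have hρ' := fun j hj => (hρ j hj).isIdempotentElem
  induction p with
  | zero => simp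
  | succ p ih =>
    have ih := ih (by omega)
    have h1 := prodAct_congr ih
    have him : ∀ {π : ℕ → Mat n}, (∀ j ∈ Finset.Icc 1 k, π j * π j = π j) → ∀ u,
        u ∈ im (π (p + 1)) ↔ ∃ x ∈ fibre π k (p + 1), prodAct π p (ext k x) 0 = u := by
      intro π hπ u
      constructor
      · intro hu
        obtain ⟨x, hx, rfl⟩ := exists_mem_fibre (k := k) (p := p) hπ (by omega) u
        exact ⟨x, (mem_fibre_succ hπ (by omega)).2 ⟨hx, hu⟩, rfl⟩
      · rintro ⟨x, hx, rfl⟩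
        exact ((mem_fibre_succ hπ (by omega)).1 hx).2
    have h2 : π (p + 1) = ρ (p + 1) := by
      refine eq_of_im_eq (hπ _ (by simp; omega)) (hρ _ (by simp; omega)) ?_
      ext u
      rw [him hπ', him hρ', h1, fibre_eq_of_fibre_eq hπ' htr hρ' htr' h hp]
    intro i hi
    rcases eq_or_lt_of_le (Finset.mem_Icc.1 hi).2 with rfl | h3
    · exact h2
    · exact ih i (by simp at hi ⊢; omega)

end Sections

/-! ### The Grassmannian model of an extended uniton -/

section Model

variable {n k : ℕ}

/-- The Grassmannian model of an extended uniton has a polynomial frame. -/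
theorem exists_model {φ : ℂ → ℂ → Mat n} {π : ℕ → ℂ → Mat n} (hφ : IsExtendedUniton φ)
    (hπ : IsMinimalFactorization φ k π) {m : ℕ → ℕ}
    (hm : ∀ j ∈ Finset.Icc 1 k, ∀ w, Module.finrank ℂ (im (π j w)) = m j) :
    ∃ (d : ℕ) (U : ℂ → Mat n) (c : Matrix (Fin d) (Fin k × Fin n) ℂ)
      (p : Matrix (Fin k × Fin n) (Fin d) ℂ[X]) (q : ℂ[X]), q ≠ 0 ∧
      (∀ w, Module.finrank ℂ (fibre (fun i => π i w) k k) = d) ∧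
      (∀ w j, wdM (-Complex.I) (fun z => coef (fun i => π i z) k (j + 1)) w
        = U w * coef (fun i => π i w) k j) ∧
      (∀ w i, ev w (fun a => p a i) ∈ fibre (fun i => π i w) k k) ∧
      c.map C * p = q • (1 : Matrix (Fin d) (Fin d) ℂ[X]) := by
  have hidem : ∀ w, ∀ j ∈ Finset.Icc 1 k, π j w * π j w = π j w := fun w j hj =>
    (hπ.proj j hj w).isIdempotentElem
  have hd : ∀ j a b, Differentiable ℝ fun w => coef (fun i => π i w) k j a b := fun j a b =>
    differentiable_coef (fun j hj a b => (hπ.smooth j hj a b).differentiable (by simp)) le_rfl j a b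
  have hC0 : ∀ z, coef (fun i => π i z) k 0 = 1 := fun z => coef_zero _ _
  have hCk : ∀ j, k < j → ∀ z, coef (fun i => π i z) k j = 0 := fun j hj z => coef_eq_zero _ hj
  obtain ⟨U, V, hUV⟩ := exists_wd_coef_eq hφ (C := fun j z => coef (fun i => π i z) k j) hd hC0 hCk
    fun z l hl => (hπ.factor z l hl).trans (simpleProd_eq _ k hl)
  obtain ⟨K, hK, hφK⟩ := hφ.sphere
  have hunit : ∀ w, star (φ w 0) * φ w 0 = 1 := by
    intro w
    have h := hφ.ward.reality (w.re, w.im, 0) 0 hφ.ward.zero_mem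
      (by rw [map_zero]; exact hφ.ward.zero_mem)
    simpa only [map_zero, Complex.re_add_im] using h
  have hL := exists_tendsto_coef hd hCk hC0
    (fun j => coef_entriesO (fun j hj w => hπ.proj j hj w) le_rfl j) hunit hK hφK
    (fun w => (hUV w).1) (fun w => (hUV w).2.1) (fun w => (hUV w).2.2.1) (fun w => (hUV w).2.2.2)
  choose L hL using hL
  have hker : ∀ w, Module.finrank ℂ (fibre (fun i => π i w) k k) =
      k * n - ∑ j ∈ Finset.range k, (n - m (j + 1)) := by
    intro w
    rw [finrank_fibre (hidem w) le_rfl]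
    congr 1
    exact Finset.sum_congr rfl fun j hj => by
      rw [hm (j + 1) (by simp at hj ⊢; omega)]
  obtain ⟨c, p, q, hq, hp, hcp⟩ := exists_polynomial_frame
    (H := fun w => hankel (coef (fun i => π i w) k) k) (Hlim := hankel L k)
    (fun a b => hd _ _ _) (fun w => (ker_hankel _ k).symm ▸ hker w)
    (fun w x hx => wdM_hankel_mulVec_eq_zero (C := fun j z => coef (fun i => π i z) k j)
      (hUV w).2.1 hCk hx)
    (tendsto_pi_nhds.2 fun a => tendsto_pi_nhds.2 fun b =>
      tendsto_pi_nhds.1 (tendsto_pi_nhds.1 (hL _) _) _)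
    (finrank_ker_limit (fun j hj w => hπ.proj j hj w) hm hL)
  refine ⟨_, U, c, p, q, hq, hker, fun w => (hUV w).1, fun w i => ?_, hcp⟩
  rw [← ker_hankel, mem_ker]
  funext a
  exact congrFun (congrFun (hp w) a) i

/-- Off the zeros of `q`, the polynomial frame spans. -/
theorem exists_coordinates {ι : Type*} [Fintype ι] {d : ℕ} {E : Submodule ℂ (ι → ℂ)}
    (hE : Module.finrank ℂ E = d) {c : Matrix (Fin d) ι ℂ} {p : Matrix ι (Fin d) ℂ[X]} {q : ℂ[X]}
    {w : ℂ} (hq : q.eval w ≠ 0) (hp : ∀ i, ev w (fun a => p a i) ∈ E)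
    (hcp : c.map C * p = q • (1 : Matrix (Fin d) (Fin d) ℂ[X])) {x : ι → ℂ} (hx : x ∈ E) :
    q.eval w • x = (p.map (eval w)).mulVec (c.mulVec x) := by
  have hcp' : c * p.map (eval w) = q.eval w • 1 := by
    ext i j
    have h := congrArg (eval w) (congrFun (congrFun hcp i) j)
    simp only [Matrix.mul_apply, Matrix.map_apply, eval_finsetSum, eval_mul, eval_C,
      Matrix.smul_apply, smul_eq_mul, Matrix.one_apply] at h ⊢
    rw [h]
    split_ifs <;> simp
  have hinj : LinearMap.ker (p.map (eval w)).mulVecLin = ⊥ := by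
    rw [LinearMap.ker_eq_bot']
    intro y hy
    have h1 : (c * p.map (eval w)).mulVec y = 0 := by
      rw [← Matrix.mulVec_mulVec]
      exact (congrArg c.mulVec hy).trans (Matrix.mulVec_zero _)
    rw [hcp', Matrix.smul_mulVec, Matrix.one_mulVec] at h1
    exact (smul_eq_zero_iff_right hq).1 h1
  have hle : LinearMap.range (p.map (eval w)).mulVecLin ≤ E := by
    rintro _ ⟨y, rfl⟩
    have h1 : (p.map (eval w)).mulVecLin y = ∑ i, y i • ev w (fun a => p a i) := by
      funext a
      simp only [Matrix.mulVecLin_apply, Matrix.mulVec, dotProduct, Finset.sum_apply,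
        Pi.smul_apply, smul_eq_mul, ev, Matrix.map_apply]
      exact Finset.sum_congr rfl fun i _ => mul_comm _ _
    rw [h1]
    exact Submodule.sum_mem _ fun i _ => Submodule.smul_mem _ _ (hp i)
  have heq := Submodule.eq_of_le_of_finrank_eq hle (by
    rw [LinearMap.finrank_range_of_inj (LinearMap.ker_eq_bot.1 hinj), hE, Module.finrank_fin_fun])
  rw [← heq] at hx
  obtain ⟨y, rfl⟩ := hx
  rw [Matrix.mulVecLin_apply, Matrix.mulVec_mulVec y c, hcp', Matrix.smul_mulVec, Matrix.one_mulVec,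
    Matrix.mulVec_smul]

/-- The obstruction to the derivative of a section being a section. -/
noncomputable def obstruction {ι : Type*} [Fintype ι] {d : ℕ} (c : Matrix (Fin d) ι ℂ)
    (p : Matrix ι (Fin d) ℂ[X]) (q : ℂ[X]) (x : ι → ℂ[X]) : ι → ℂ[X] :=
  q • dv x - p.mulVec ((c.map C).mulVec (dv x))

theorem obstruction_add_smul {ι : Type*} [Fintype ι] {d : ℕ} (c : Matrix (Fin d) ι ℂ)
    (p : Matrix ι (Fin d) ℂ[X]) (q : ℂ[X]) (x y : ι → ℂ[X]) (ε : ℂ) :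
    obstruction c p q (x + C ε • y) = obstruction c p q x + C ε • obstruction c p q y := by
  have h : dv (x + C ε • y) = dv x + C ε • dv y := by
    funext a
    simp [dv]
  rw [obstruction, h, Matrix.mulVec_add, Matrix.mulVec_add, Matrix.mulVec_smul, Matrix.mulVec_smul,
    obstruction, obstruction, smul_add, smul_sub, smul_comm q]
  abel

theorem ev_obstruction_eq_zero {ι : Type*} [Fintype ι] {d : ℕ} {E : Submodule ℂ (ι → ℂ)}
    (hE : Module.finrank ℂ E = d) {c : Matrix (Fin d) ι ℂ} {p : Matrix ι (Fin d) ℂ[X]} {q : ℂ[X]}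
    {w : ℂ} (hq : q.eval w ≠ 0) (hp : ∀ i, ev w (fun a => p a i) ∈ E)
    (hcp : c.map C * p = q • (1 : Matrix (Fin d) (Fin d) ℂ[X])) {x : ι → ℂ[X]}
    (hx : ev w (dv x) ∈ E) : ev w (obstruction c p q x) = 0 := by
  have h := exists_coordinates hE hq hp hcp hx
  funext a
  have h1 := congrFun h a
  simp only [ev, obstruction, Pi.sub_apply, Pi.smul_apply, smul_eq_mul, eval_sub, eval_mul,
    Matrix.mulVec, dotProduct, eval_finsetSum, Matrix.map_apply, eval_C, Pi.zero_apply] at h1 ⊢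
  rw [h1, sub_self]

/-- If the frame satisfies all the differential relations, then it is constant up to a factor. -/
theorem exists_eq_C_mul_of_obstruction {ι : Type*} [Fintype ι] {d : ℕ} {c : Matrix (Fin d) ι ℂ}
    {p : Matrix ι (Fin d) ℂ[X]} {q : ℂ[X]} (hq : q ≠ 0)
    (hcp : c.map C * p = q • (1 : Matrix (Fin d) (Fin d) ℂ[X]))
    (h : ∀ i, obstruction c p q (fun a => p a i) = 0) : ∃ κ : Matrix ι (Fin d) ℂ,
      ∀ a i, p a i = C (κ a i) * q := by
  have h1 : ∀ i, (c.map C).mulVec (dv fun a => p a i) = Pi.single i (derivative q) := by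
    intro i
    funext j
    have h2 := congrArg derivative (congrFun (congrFun hcp j) i)
    simp only [Matrix.mul_apply, Matrix.map_apply, derivative_sum, derivative_mul, derivative_C,
      zero_mul, zero_add, Matrix.smul_apply, smul_eq_mul, Matrix.one_apply] at h2
    rw [Matrix.mulVec, dotProduct]
    refine h2.trans ?_
    rw [Pi.single_apply]
    split_ifs <;> simp
  have h2 : ∀ a i, ∃ κ, p a i = C κ * q := by
    intro a i
    refine exists_eq_C_mul_of_wronskian hq ?_
    have h3 := congrFun (h i) a
    rw [obstruction, h1, Pi.sub_apply, Matrix.mulVec_single] at h3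
    simpa [sub_eq_zero, dv] using h3
  choose κ hκ using h2
  exact ⟨κ, hκ⟩

/-- Values of sections and of their derivatives. -/
theorem prodAct_derivative_mem {π : ℕ → ℂ → Mat n} {U : ℂ → Mat n}
    (hπc : ∀ j ∈ Finset.Icc 1 k, ∀ a b, ContDiff ℝ ∞ fun w => π j w a b)
    (hπ : ∀ j ∈ Finset.Icc 1 k, ∀ w, IsStarProjection (π j w)) {S : Set ℂ} (hS : S.Finite)
    (htr : ∀ w ∉ S, ∀ j ∈ Finset.Icc 2 k, im (π j w) ⊓ im (perp (π (j - 1) w)) = ⊥)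
    (hU : ∀ w j, wdM (-Complex.I) (fun z => coef (fun i => π i z) k (j + 1)) w
      = U w * coef (fun i => π i w) k j)
    {x : Fin k × Fin n → ℂ[X]} (hx : ∀ w, ev w x ∈ fibre (fun i => π i w) k k) {j p : ℕ}
    (hjp : p + 1 + j ≤ k) (w : ℂ) :
    prodAct (fun i => π i w) p (ext k (ev w (dv^[j] x))) 0 ∈ im (π (p + 1) w) := by
  have hp : p + 1 ∈ Finset.Icc 1 k := by simp; omega
  have hπd : ∀ j ∈ Finset.Icc 1 k, ∀ a b, Differentiable ℝ fun w => π j w a b :=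
    fun j hj a b => (hπc j hj a b).differentiable (by simp)
  have hidem : ∀ w, ∀ j ∈ Finset.Icc 1 k, π j w * π j w = π j w := fun w j hj =>
    (hπ j hj w).isIdempotentElem
  have hgen : ∀ w ∉ S, (perp (π (p + 1) w)).mulVec
      (prodAct (fun i => π i w) p (ext k (ev w (dv^[j] x))) 0) = 0 := by
    intro w hw
    -- A pole of order at most `j` at level `k` is gone at level `k - j`, hence also at level `p + 1
    -- ≤ k - j`, which is the membership. Points of `S` are then reached by continuity.
    have h1 := regular_prodAct_derivative
      (fun j a b => differentiable_coef hπd le_rfl j a b) hU hx j w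
    have h2 := regular_prodAct_of_pole (hidem w) (htr w hw) j (p := k - j) (by omega)
      (ext_regular _) (by rwa [Nat.sub_add_cancel (by omega)])
    have h3 := regular_prodAct_of_le (hidem w) (r := k - j) (p := p + 1) (by omega) (by omega)
      (ext_regular _) h2
    exact ((regular_prodAct_succ_iff (hidem w) (by omega) (ext_regular _) 0).1 h3).2
  have hcont : Continuous fun w => (perp (π (p + 1) w)).mulVec
      (prodAct (fun i => π i w) p (ext k (ev w (dv^[j] x))) 0) := by
    simp only [prodAct_apply, ← Matrix.smul_mulVec]
    refine Continuous.matrix_mulVec ?_ (continuous_finsetSum _ fun i _ => ?_)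
    · exact continuous_const.sub (continuous_pi fun a => continuous_pi fun b =>
        (hπd _ hp a b).continuous)
    · refine Continuous.matrix_mulVec (continuous_pi fun a => continuous_pi fun b =>
        (differentiable_coef hπd (m := p) (by omega) i a b).continuous) (continuous_pi fun l => ?_)
      by_cases h : (0 : ℤ) ≤ 0 + i ∧ (0 + i : ℤ) < k
      · simp only [ext, LinearMap.coe_mk, AddHom.coe_mk, dif_pos h, ev]
        exact Polynomial.continuous _
      · simp only [ext, LinearMap.coe_mk, AddHom.coe_mk, dif_neg h]
        exact continuous_const
  rw [mem_im_iff_perp (hidem w _ hp)]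
  have h := hcont.ext_on (hS.countable.dense_compl ℝ) continuous_const fun w hw => hgen w hw
  exact congrFun h w

end Model

/-! ### Choice of the sections -/

section Selection

variable {n k : ℕ}

/-- The leading coefficient `a_0` of `(a_0, …, a_{k-1})`. -/
def lead (hk : 1 ≤ k) {R : Type*} (x : Fin k × Fin n → R) : Fin n → R := fun l => x (⟨0, hk⟩, l)

theorem ext_zero (hk : 1 ≤ k) (x : Fin k × Fin n → ℂ) : ext k x 0 = lead hk x := by
  funext l
  exact ext_natCast x ⟨0, hk⟩ l

/-- On the fibre the maps `x ↦ a_0` and `x ↦ v_k` have the same kernel, and the second has image `Im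
π_k`. -/
theorem finrank_map_lead (hk : 1 ≤ k) {π : ℕ → Mat n}
    (hπ : ∀ j ∈ Finset.Icc 1 k, π j * π j = π j)
    (htr : ∀ j ∈ Finset.Icc 2 k, im (π j) ⊓ im (perp (π (j - 1))) = ⊥) :
    Module.finrank ℂ ((fibre π k k).map (LinearMap.proj 0 ∘ₗ ext k)) =
      Module.finrank ℂ (im (π k)) := by
  obtain ⟨p, rfl⟩ := Nat.exists_eq_add_of_le' hk
  let f := (LinearMap.proj 0 ∘ₗ ext (n := n) (p + 1)) ∘ₗ (fibre π (p + 1) (p + 1)).subtype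
  let g := (LinearMap.proj 0 ∘ₗ prodAct π p ∘ₗ ext (p + 1)) ∘ₗ
    (fibre π (p + 1) (p + 1)).subtype
  have hf : LinearMap.range f = (fibre π (p + 1) (p + 1)).map (LinearMap.proj 0 ∘ₗ ext (p + 1)) := by
    rw [LinearMap.range_comp, Submodule.range_subtype]
  have hg : LinearMap.range g = im (π (p + 1)) := by
    ext u
    constructor
    · rintro ⟨x, rfl⟩
      exact ((mem_fibre_succ hπ (by omega)).1 x.2).2
    · intro hu
      obtain ⟨x, hx, rfl⟩ := exists_mem_fibre (k := p + 1) (p := p) hπ (by omega) u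
      exact ⟨⟨x, (mem_fibre_succ hπ (by omega)).2 ⟨hx, hu⟩⟩, rfl⟩
  have hker : LinearMap.ker f = LinearMap.ker g := by
    ext x
    exact (prodAct_ext_eq_zero_iff hπ htr hk x.2).symm
  have h1 := f.finrank_range_add_finrank_ker
  have h2 := g.finrank_range_add_finrank_ker
  rw [← hf, ← hg]
  rw [hker] at h1
  omega

/-- Sections with independent leading coefficients whose derivatives are not sections, unless the
derivatives of all sections are sections. -/
theorem exists_sections (hk : 1 ≤ k) {E : Submodule ℂ (Fin k × Fin n → ℂ)} {d r : ℕ}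
    (hE : Module.finrank ℂ E = d) {c : Matrix (Fin d) (Fin k × Fin n) ℂ}
    {p : Matrix (Fin k × Fin n) (Fin d) ℂ[X]} {q : ℂ[X]} {w₀ : ℂ} (hq : q.eval w₀ ≠ 0)
    (hp : ∀ i, ev w₀ (fun a => p a i) ∈ E)
    (hcp : c.map C * p = q • (1 : Matrix (Fin d) (Fin d) ℂ[X]))
    (hr : Module.finrank ℂ (E.map (LinearMap.proj 0 ∘ₗ ext k)) = r) :
    ∃ x : Fin r → Fin k × Fin n → ℂ[X],
      (∀ t, ∃ (i i₀ : Fin d) (ε : ℂ), x t = (fun a => p a i) + C ε • fun a => p a i₀) ∧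
      (LinearIndependent ℂ fun t => ev w₀ (lead hk (x t))) ∧
      ((∃ i, obstruction c p q (fun a => p a i) ≠ 0) → ∀ t, obstruction c p q (x t) ≠ 0) := by
  have hspan : E.map (LinearMap.proj 0 ∘ₗ ext k) =
      Submodule.span ℂ (Set.range fun i => ev w₀ (lead hk fun a => p a i)) := by
    apply le_antisymm
    · rintro _ ⟨x, hx, rfl⟩
      have h := exists_coordinates hE hq hp hcp hx
      rw [← Submodule.smul_mem_iff _ hq, ← map_smul, h]
      have h1 : (LinearMap.proj 0 ∘ₗ ext k : (Fin k × Fin n → ℂ) →ₗ[ℂ] Vec n)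
          ((p.map (eval w₀)).mulVec (c.mulVec x)) =
          ∑ i, (c.mulVec x) i • ev w₀ (lead hk fun a => p a i) := by
        refine (ext_zero hk _).trans ?_
        funext l
        simp only [lead, Matrix.mulVec, dotProduct, Matrix.map_apply, Finset.sum_apply,
          Pi.smul_apply, smul_eq_mul, ev]
        exact Finset.sum_congr rfl fun i _ => mul_comm _ _
      rw [h1]
      exact Submodule.sum_mem _ fun i _ =>
        Submodule.smul_mem _ _ (Submodule.subset_span ⟨i, rfl⟩)
    · rw [Submodule.span_le]
      rintro _ ⟨i, rfl⟩
      exact ⟨_, hp i, ext_zero hk _⟩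
  obtain ⟨f, hf, -, hfi⟩ := Submodule.exists_fun_fin_finrank_span_eq ℂ
    (Set.range fun i => ev w₀ (lead hk fun a => p a i))
  choose i hi using hf
  have hr' : Module.finrank ℂ (Submodule.span ℂ
      (Set.range fun i => ev w₀ (lead hk fun a => p a i))) = r := by rw [← hspan, hr]
  let τ : Fin r → Fin d := fun t => i (Fin.cast hr'.symm t)
  have hτ : LinearIndependent ℂ fun t => ev w₀ (lead hk fun a => p a (τ t)) := by
    have h : (fun t => ev w₀ (lead hk fun a => p a (τ t))) = f ∘ Fin.cast hr'.symm :=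
      funext fun t => hi _
    rw [h]
    exact hfi.comp _ (Fin.cast_injective _)
  by_cases hob : ∃ i, obstruction c p q (fun a => p a i) ≠ 0
  · obtain ⟨i₀, hi₀⟩ := hob
    classical
    -- Only columns with zero obstruction are perturbed, by a small nonzero multiple of an
    -- obstructed column; independence at `w₀` is an open condition and survives.
    let δ : Fin r → ℂ := fun t => if obstruction c p q (fun a => p a (τ t)) = 0 then 1 else 0
    have hcont : Continuous fun ε : ℂ => fun t : Fin r =>
        ev w₀ (lead hk fun a => p a (τ t)) + (ε * δ t) • ev w₀ (lead hk fun a => p a i₀) := by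
      fun_prop
    have hopen := (isOpen_setOfPred_linearIndependent (𝕜 := ℂ) (E := Vec n)
      (ι := Fin r)).preimage hcont
    have hmem := hopen.mem_nhds (x := (0 : ℂ)) (by simpa using hτ)
    obtain ⟨ε, hε, hε0⟩ := Filter.nonempty_of_mem (f := 𝓝[≠] (0 : ℂ))
      (Filter.inter_mem (mem_nhdsWithin_of_mem_nhds hmem) self_mem_nhdsWithin)
    refine ⟨fun t => (fun a => p a (τ t)) + C (ε * δ t) • fun a => p a i₀,
      fun t => ⟨_, _, _, rfl⟩, ?_, fun _ t => ?_⟩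
    · have h : (fun t => ev w₀ (lead hk ((fun a => p a (τ t)) + C (ε * δ t) • fun a => p a i₀))) =
          fun t => ev w₀ (lead hk fun a => p a (τ t)) +
            (ε * δ t) • ev w₀ (lead hk fun a => p a i₀) := by
        funext t l
        simp [ev, lead]
      change LinearIndependent ℂ fun t =>
        ev w₀ (lead hk ((fun a => p a (τ t)) + C (ε * δ t) • fun a => p a i₀))
      rw [h]
      exact hε
    · rw [obstruction_add_smul]
      by_cases h : obstruction c p q (fun a => p a (τ t)) = 0
      · simp only [δ, if_pos h]
        rw [h, zero_add, mul_one]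
        exact smul_ne_zero (C_ne_zero.2 hε0) hi₀
      · simp only [δ, if_neg h]
        simpa using h
  · refine ⟨fun t a => p a (τ t), fun t => ⟨τ t, τ t, 0, ?_⟩, hτ, fun h => absurd h hob⟩
    funext a
    simp

end Selection

end Uniton

/-! ### The main theorem -/

theorem mainTheorem9 (n k : ℕ) (hk : 1 ≤ k) (φ : ℂ → ℂ → Uniton.Mat n)
    (π : ℕ → ℂ → Uniton.Mat n) (hφ : Uniton.IsExtendedUniton φ)
    (hπ : Uniton.IsMinimalFactorization φ k π) (m : ℕ → ℕ)
    (hm : ∀ j ∈ Finset.Icc 1 k, ∀ w, Module.finrank ℂ (Uniton.im (π j w)) = m j) :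
    ∃ (s : ℕ) (r : Fin s → ℕ) (a : Fin s → ℕ → Fin n → RatFunc ℂ),
      (∀ i, 0 < r i) ∧ ∑ i, r i = m k ∧
      (∀ i, ∀ j ≤ r i + k - 2, ∀ w, Uniton.RegularAt (a i 0) w →
        iteratedDeriv j (Uniton.ratMap (a i 0)) w ∈ Uniton.im (π 1 w)) ∧
      (∀ i, ∀ p ∈ Finset.Icc 1 (k - 1), ∀ j ≤ r i + k - p - 1, ∀ w,
        (∀ q < p, Uniton.RegularAt (a i q) w) →
          Uniton.Dv π (a i) j p w ∈ Uniton.im (π p w)) ∧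
      ∃ S : Set ℂ, S.Finite ∧ ∀ w ∉ S,
        (∀ i, ∀ q < k, Uniton.RegularAt (a i q) w) ∧
        Submodule.span ℂ {x | ∃ i, ∃ ℓ < r i, x = Uniton.Dv π (a i) ℓ k w}
          = Uniton.im (π k w) ∧
        ((∃ j ∈ Finset.Icc 1 k, ∃ w₁ w₂, π j w₁ ≠ π j w₂) →
          ∀ i, Uniton.Dv π (a i) (r i) k w ∉ Uniton.im (π k w)) := by
  open Uniton in
  obtain ⟨d, U, c, p, q, hq, hE, hU, hp, hcp⟩ := exists_model hφ hπ hm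
  obtain ⟨S₀, hS₀, htr⟩ := hπ.transverse
  have hidem : ∀ w, ∀ j ∈ Finset.Icc 1 k, π j w * π j w = π j w := fun w j hj =>
    (hπ.proj j hj w).isIdempotentElem
  have hroots : {w | q.IsRoot w}.Finite := Polynomial.finite_setOfPred_isRoot hq
  obtain ⟨w₀, hw₀⟩ := (hS₀.union hroots).infinite_compl.nonempty
  simp only [Set.mem_compl_iff, Set.mem_union, not_or] at hw₀
  obtain ⟨x, hx, hxi, hxo⟩ := exists_sections hk (r := m k) (hE w₀) hw₀.2 (hp w₀) hcp
    (by rw [finrank_map_lead hk (hidem w₀) (htr w₀ hw₀.1), hm k (by simp; omega)])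
  have hxE : ∀ t w, ev w (x t) ∈ fibre (fun i => π i w) k k := by
    intro t w
    obtain ⟨i, i₀, ε, h⟩ := hx t
    have h1 : ev w (x t) = ev w (fun a => p a i) + ε • ev w (fun a => p a i₀) := by
      funext a
      simp [h, ev]
    rw [h1]
    exact add_mem (hp w i) (Submodule.smul_mem _ _ (hp w i₀))
  have hmem : ∀ t (j p' : ℕ), p' + 1 + j ≤ k → ∀ w,
      Dv π (ratTuple (x t)) j (p' + 1) w ∈ im (π (p' + 1) w) := by
    intro t j p' h w
    rw [Dv_ratTuple]
    exact prodAct_derivative_mem hπ.smooth hπ.proj hS₀ htr hU (hxE t) h w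
  obtain ⟨SD, hSD, hSD'⟩ : ∃ SD : Set ℂ, SD.Finite ∧
      ((∃ j ∈ Finset.Icc 1 k, ∃ w₁ w₂, π j w₁ ≠ π j w₂) →
        ∀ w ∉ SD, ∀ t, ev w (obstruction c p q (x t)) ≠ 0) := by
    by_cases hob : ∃ i, obstruction c p q (fun a => p a i) ≠ 0
    · have h1 : ∀ t, ∃ a, obstruction c p q (x t) a ≠ 0 := fun t =>
        Function.ne_iff.1 (hxo hob t)
      choose a ha using h1
      refine ⟨⋃ t, {w | (obstruction c p q (x t) (a t)).IsRoot w},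
        Set.finite_iUnion fun t => Polynomial.finite_setOfPred_isRoot (ha t), fun _ w hw t h => hw ?_⟩
      exact Set.mem_iUnion.2 ⟨t, congrFun h (a t)⟩
    · refine ⟨∅, Set.finite_empty, fun hnc => absurd hnc ?_⟩
      -- Without obstruction the frame is a constant matrix times `q`, so the fibre is the same at
      -- all generic points and every `π_j` is constant.
      push Not at hob ⊢
      obtain ⟨κ, hκ⟩ := exists_eq_C_mul_of_obstruction hq hcp hob
      have hfib : ∀ w, q.eval w ≠ 0 → fibre (fun i => π i w) k k =
          Submodule.span ℂ (Set.range fun i a => κ a i) := by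
        intro w hw
        have h2 : ∀ i, ev w (fun a => p a i) = q.eval w • fun a => κ a i := by
          intro i
          funext a
          simp [ev, hκ, mul_comm]
        apply le_antisymm
        · intro y hy
          have h3 := exists_coordinates (hE w) hw (hp w) hcp hy
          rw [← Submodule.smul_mem_iff _ hw, h3]
          have h4 : (p.map (Polynomial.eval w)).mulVec (c.mulVec y) =
              ∑ i, (c.mulVec y) i • ev w (fun a => p a i) := by
            funext a
            simp only [Matrix.mulVec, dotProduct, Matrix.map_apply, Finset.sum_apply,
              Pi.smul_apply, smul_eq_mul, ev]
            exact Finset.sum_congr rfl fun i _ => mul_comm _ _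
          rw [h4]
          refine Submodule.sum_mem _ fun i _ => Submodule.smul_mem _ _ ?_
          rw [h2]
          exact Submodule.smul_mem _ _ (Submodule.subset_span ⟨i, rfl⟩)
        · rw [Submodule.span_le]
          rintro _ ⟨i, rfl⟩
          have h3 := hp w i
          rw [h2] at h3
          exact (Submodule.smul_mem_iff _ hw).1 h3
      have hconst : ∀ j ∈ Finset.Icc 1 k, ∀ w, π j w = π j w₀ := by
        intro j hj
        have hc : Continuous (π j) := continuous_pi fun a => continuous_pi fun b =>
          (hπ.smooth j hj a b).continuous
        have := hc.ext_on ((hS₀.union hroots).countable.dense_compl ℝ)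
          (continuous_const (y := π j w₀)) (fun w hw => ?_)
        · exact congrFun this
        · simp only [Set.mem_compl_iff, Set.mem_union, not_or] at hw
          exact eq_of_fibre_eq (fun j hj => hπ.proj j hj w) (htr w hw.1)
            (fun j hj => hπ.proj j hj w₀) (htr w₀ hw₀.1)
            ((hfib w hw.2).trans (hfib w₀ hw₀.2).symm) le_rfl j hj
      intro j hj w₁ w₂
      rw [hconst j hj w₁, hconst j hj w₂]
  -- All `r_i` are `1`, so `s = m_k`, and the bounds on the number of derivatives become `k - 1` for
  -- `a_0` and `k - p` at level `p`.
  refine ⟨m k, fun _ => 1, fun t => ratTuple (x t), fun _ => one_pos, by simp, ?_, ?_,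
    S₀ ∪ {w | q.IsRoot w} ∪ {w | ¬ LinearIndependent ℂ fun t => ev w (lead hk (x t))} ∪ SD,
    ((hS₀.union hroots).union (finite_not_linearIndependent hxi)).union hSD, fun w hw => ?_⟩
  · intro t j (hj : j ≤ 1 + k - 2) w _
    have h := hmem t j 0 (by omega) w
    rw [Dv_ratTuple] at h
    rw [iteratedDeriv_ratMap_ratTuple]
    exact h
  · intro t p' hp' j (hj : j ≤ 1 + k - p' - 1) w _
    obtain ⟨h1, h2⟩ := Finset.mem_Icc.1 hp'
    obtain ⟨p', rfl⟩ := Nat.exists_eq_add_of_le' h1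
    exact hmem t j p' (by omega) w
  · simp only [Set.mem_union, not_or, Set.mem_ofPred_eq, not_not] at hw
    obtain ⟨⟨⟨hw1, hw2⟩, hw3⟩, hw4⟩ := hw
    obtain ⟨k, rfl⟩ := Nat.exists_eq_add_of_le' hk
    refine ⟨fun t q _ => regularAt_ratTuple _ _ _, ?_, fun hnc t hmem' => ?_⟩
    · have hset : {y | ∃ t : Fin (m (k + 1)), ∃ ℓ < 1, y = Dv π (ratTuple (x t)) ℓ (k + 1) w} =
          Set.range fun t => Dv π (ratTuple (x t)) 0 (k + 1) w := by
        ext y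
        simp [eq_comm]
      rw [hset]
      have hli : LinearIndependent ℂ fun t => Dv π (ratTuple (x t)) 0 (k + 1) w := by
        refine Fintype.linearIndependent_iff.2 fun g hg => ?_
        refine Fintype.linearIndependent_iff.1 hw3 g ?_
        have h1 : ∑ t, g t • ev w (x t) ∈ fibre (fun i => π i w) (k + 1) (k + 1) :=
          Submodule.sum_mem _ fun t _ => Submodule.smul_mem _ _ (hxE t w)
        have h2 := (prodAct_ext_eq_zero_iff (hidem w) (htr w hw1) hk h1).1 (by
          rw [← hg]
          simp only [Dv_ratTuple, map_sum, map_smul, Finset.sum_apply, Pi.smul_apply]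
          rfl)
        rw [ext_zero hk] at h2
        rw [← h2]
        funext l
        simp [lead, ev]
      refine Submodule.eq_of_le_of_finrank_eq ?_ ?_
      · rw [Submodule.span_le]
        rintro _ ⟨t, rfl⟩
        exact hmem t 0 k (by omega) w
      · rw [finrank_span_eq_card hli, Fintype.card_fin, hm _ (by simp)]
    · rw [Dv_ratTuple] at hmem'
      -- Here `k + 1` is the number of factors. The derivative `x'` has at most a simple pole at the
      -- top level, so it is regular at level `k`; if its constant term there also lay in `Im
      -- π_{k+1}`, then `x'` would be in the fibre and its obstruction would vanish at `w`.
      have h1 := regular_prodAct_derivative (fun j a b => differentiable_coef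
        (fun j hj a b => (hπ.smooth j hj a b).differentiable (by simp)) le_rfl j a b) hU (hxE t) 1 w
      have h2 := regular_prodAct_of_pole (hidem w) (htr w hw1) 1 (p := k) le_rfl (ext_regular _) h1
      exact hSD' hnc w hw4 t (ev_obstruction_eq_zero (hE w) hw2 (hp w) hcp
        ((mem_fibre_succ (hidem w) (by omega)).2 ⟨h2, hmem'⟩))
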